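/- Consider a two-party Bell scenario: Alice has $m_A$ inputs, input $x$ having $d_{A,x}$ outputs, and Bob has $m_B$ inputs, input $y$ having $d_{B,y}$ outputs (all these numbers arbitrary). A box is a vector $P=(P(a,b|x,y))\in\mathbb{R}^n$, $n=(\sum_x d_{A,x})(\sum_y d_{B,y})$. Let $\mathbf{NS}$ be the polytope of non-negative, normalized, no-signalling boxes; let $\mathbf{C}$ be the classical (Bell) polytope, i.e. the convex hull of the boxes in $\mathbf{NS}$ with all entries in $\{0,1\}$; let $\mathbf{Q}$ be the set of quantum boxes $P(a,b|x,y)=\mathrm{Tr}[\rho\,(E^A_{x,a}\otimes E^B_{y,b})]$, where $\rho$ is a density matrix on $\mathbb{C}^{N}\otimes\mathbb{C}^{N'}$ ($N,N'$ arbitrary) and $\{E^A_{x,a}\}_a$, $\{E^B_{y,b}\}_b$ are complete families of mutually orthogonal projections for each $x$ and each $y$. Let $\mathbf{Q}_{1+AB}$ (the almost quantum set) be the set of boxes $P\in\mathbf{NS}$ for which there is a complex positive semidefinite matrix $\Gamma$, indexed by the formal operators $\{\mathbb{1}\}\cup\{E^A_{x,a}E^B_{y,b}\}$, with $\Gamma_{\mathbb{1},\mathbb{1}}=1$,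 $\Gamma_{\mathbb{1},E^A_{x,a}E^B_{y,b}}=P(a,b|x,y)$, $\Gamma_{Q,R}=\Gamma_{S,T}$ whenever $Q^\dagger R=S^\dagger T$ and $\Gamma_{Q,R}=0$ whenever $Q^\dagger R=0$, where these products are simplified by $E^A_{x,a}E^A_{x,a'}=\delta_{a,a'}E^A_{x,a}$, $E^B_{y,b}E^B_{y,b'}=\delta_{b,b'}E^B_{y,b}$ and the commutation of Alice's with Bob's operators. For a polytope $K$, the inequality $B\cdot P\le\omega$ supports a facet of $K$ if it holds for all $P\in K$ and $\{P\in K: B\cdot P=\omega\}$ is non-empty of dimension $\dim K-1$. A facet Bell inequality (proper, or tight) is an inequality that supports a facet of $\mathbf{C}$ and does not support a facet of $\mathbf{NS}$. (1) Let $B\cdot P\le\omega$ be a facet Bell inequality in any two-party Bell scenario whose quantum value is attained at NPA level $1+AB$, i.e. $\sup_{P\in\mathbf{Q}}B\cdot P=\sup_{P\in\mathbf{Q}_{1+AB}}B\cdot P$. Then it is violated in quantum theory: there is $P\in\mathbf{Q}$ with $B\cdot P>\omega$. (2) Consider a two-player XOR game, with $m_A$ and $m_B$ questions, a probability distribution $q(x,y)$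 on the pairs of questions and a function $f(x,y)\in\{0,1\}$, where the players answer with bits $a,b$ and win if $a\oplus b=f(x,y)$. Its Bell functional is the winning probability $B\cdot P=\sum_{x,y}q(x,y)\sum_{a\oplus b=f(x,y)}P(a,b|x,y)$. If, for some $\omega$, the inequality $B\cdot P\le\omega$ supports a facet of $\mathbf{C}$ (for two outputs per input), then the game has a quantum advantage: $\sup_{P\in\mathbf{Q}}B\cdot P>\max_{P\in\mathbf{C}}B\cdot P$. -/

import Mathlib

noncomputable section

open scoped Matrix Kronecker ComplexOrder

/-- A two-party Bell scenario: Alice has `mA` inputs, her input `x` having `dA x` outputs;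
Bob has `mB` inputs, his input `y` having `dB y` outputs. -/
structure BellScenario where
  mA : ℕ
  dA : Fin mA → ℕ
  mB : ℕ
  dB : Fin mB → ℕ

namespace BellScenario

/-- Alice's (input, output) pairs. -/
abbrev LetterA (S : BellScenario) : Type := Σ x : Fin S.mA, Fin (S.dA x)

/-- Bob's (input, output) pairs. -/
abbrev LetterB (S : BellScenario) : Type := Σ y : Fin S.mB, Fin (S.dB y)

/-- Events `(a, b | x, y)`, written `(⟨x, a⟩, ⟨y, b⟩)`. -/
abbrev Event (S : BellScenario) : Type := S.LetterA × S.LetterB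

/-- Vectors of `ℝⁿ`, `n = (∑ x, dA x) * (∑ y, dB y)`; the coordinate at `(⟨x, a⟩, ⟨y, b⟩)` is
`P(a, b | x, y)`. Coefficient vectors of Bell functionals live in the same space. -/
abbrev Box (S : BellScenario) : Type := S.Event → ℝ

/-- The no-signalling polytope: nonnegative, normalized, no-signalling boxes. -/
structure IsNoSignalling (S : BellScenario) (P : S.Box) : Prop where
  nonneg : ∀ e, 0 ≤ P e
  normalized : ∀ x y, ∑ a, ∑ b, P (⟨x, a⟩, ⟨y, b⟩) = 1
  noSignallingAtoB : ∀ x x' y b, ∑ a, P (⟨x, a⟩, ⟨y, b⟩) = ∑ a', P (⟨x', a'⟩, ⟨y, b⟩)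
  noSignallingBtoA : ∀ y y' x a, ∑ b, P (⟨x, a⟩, ⟨y, b⟩) = ∑ b', P (⟨x, a⟩, ⟨y', b'⟩)

def noSignalling (S : BellScenario) : Set S.Box := {P | S.IsNoSignalling P}

/-- Local deterministic boxes: no-signalling boxes with all entries in `{0, 1}`. -/
def localDeterministic (S : BellScenario) : Set S.Box :=
  {P | S.IsNoSignalling P ∧ ∀ e, P e = 0 ∨ P e = 1}

/-- The classical (Bell) polytope. -/
def classical (S : BellScenario) : Set S.Box := convexHull ℝ S.localDeterministic

/-- A family of complete projective measurements on `ℂ^N`, one for each input: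
`E ⟨x, a⟩` is the projection for output `a` of input `x`. -/
structure IsProjectiveMeasurement {m : ℕ} {d : Fin m → ℕ} {N : ℕ}
    (E : (Σ x : Fin m, Fin (d x)) → Matrix (Fin N) (Fin N) ℂ) : Prop where
  hermitian : ∀ l, (E l).IsHermitian
  orthogonal : ∀ x a a', E ⟨x, a⟩ * E ⟨x, a'⟩ = if a = a' then E ⟨x, a⟩ else 0
  complete : ∀ x, ∑ a, E ⟨x, a⟩ = 1

/-- The set of quantum boxes: `P(a, b | x, y) = Tr[ρ (E_{x,a} ⊗ F_{y,b})]` for a state `ρ` on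
`ℂ^NA ⊗ ℂ^NB`, with `NA`, `NB` arbitrary. -/
def quantum (S : BellScenario) : Set S.Box :=
  {P | ∃ (NA NB : ℕ) (ρ : Matrix (Fin NA × Fin NB) (Fin NA × Fin NB) ℂ)
      (E : S.LetterA → Matrix (Fin NA) (Fin NA) ℂ)
      (F : S.LetterB → Matrix (Fin NB) (Fin NB) ℂ),
      ρ.PosSemidef ∧ ρ.trace = 1 ∧ IsProjectiveMeasurement E ∧ IsProjectiveMeasurement F ∧
      ∀ k l, ((P (k, l) : ℝ) : ℂ) = (ρ * (E k ⊗ₖ F l)).trace}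

/-- The product of two operators of one party, each being the identity (`none`) or one of the
formal projections (`some ⟨x, a⟩`), simplified with `E_{x,a} E_{x,a'} = δ_{a,a'} E_{x,a}`:
a reduced word in the projections, or `none` if the product is zero. -/
def localProd {m : ℕ} {d : Fin m → ℕ} :
    Option (Σ x : Fin m, Fin (d x)) → Option (Σ x : Fin m, Fin (d x)) →
      Option (List (Σ x : Fin m, Fin (d x)))
  | none, none => some []
  | none, some k => some [k]
  | some k, none => some [k]
  | some k, some l => if k = l then some [k] else if k.1 = l.1 then none else some [k, l]

/-- For `Q`, `R` in the operator set `{1} ∪ {E_{x,a} F_{y,b}}` of level `1 + AB` (`none` is the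
identity and `some (k, l)` is `E_k F_l`), the product `Q† R`. As Alice's projections commute with
Bob's, it is the pair of Alice's and Bob's reduced words, or `none` if the product is zero. -/
def adjProd (S : BellScenario) (Q R : Option S.Event) :
    Option (List S.LetterA × List S.LetterB) :=
  Option.map₂ Prod.mk (localProd (Q.map Prod.fst) (R.map Prod.fst))
    (localProd (Q.map Prod.snd) (R.map Prod.snd))

/-- `Γ` is a certificate of level `1 + AB` of the NPA hierarchy for the box `P`. -/
structure IsCertificate (S : BellScenario) (P : S.Box)
    (Γ : Matrix (Option S.Event) (Option S.Event) ℂ) : Prop where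
  posSemidef : Γ.PosSemidef
  one_one : Γ none none = 1
  consistent : ∀ Q R Q' R', S.adjProd Q R = S.adjProd Q' R' → Γ Q R = Γ Q' R'
  eq_zero : ∀ Q R, S.adjProd Q R = none → Γ Q R = 0
  box : ∀ e, Γ none (some e) = ((P e : ℝ) : ℂ)

/-- The almost quantum set, i.e. level `1 + AB` of the NPA hierarchy. -/
def almostQuantum (S : BellScenario) : Set S.Box :=
  {P | S.IsNoSignalling P ∧ ∃ Γ, S.IsCertificate P Γ}

/-- The largest value (supremum) of the Bell functional `B` over a set of boxes. -/
def value {S : BellScenario} (K : Set S.Box) (B : S.Box) : ℝ := sSup ((fun P => B ⬝ᵥ P) '' K)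

/-- The inequality `B · P ≤ ω` supports a facet of `K`: it is valid on `K`, and the face of `K`
where it is saturated is nonempty, of dimension `dim K - 1`. -/
structure IsFacet {S : BellScenario} (K : Set S.Box) (B : S.Box) (ω : ℝ) : Prop where
  valid : ∀ P ∈ K, B ⬝ᵥ P ≤ ω
  nonempty : {P ∈ K | B ⬝ᵥ P = ω}.Nonempty
  finrank_add_one : Module.finrank ℝ (vectorSpan ℝ {P ∈ K | B ⬝ᵥ P = ω}) + 1 =
    Module.finrank ℝ (vectorSpan ℝ K)

/-- `B · P ≤ ω` is a proper (tight) facet Bell inequality: it supports a facet of the classical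
polytope and does not also support a facet of the no-signalling polytope. -/
def IsFacetBellInequality (S : BellScenario) (B : S.Box) (ω : ℝ) : Prop :=
  IsFacet S.classical B ω ∧ ¬ IsFacet S.noSignalling B ω

/-- The scenario with `mA` and `mB` inputs and two outputs for every input. -/
def binary (mA mB : ℕ) : BellScenario := ⟨mA, fun _ => 2, mB, fun _ => 2⟩

end BellScenario

/-- A two-player XOR game: the questions `(x, y)` are drawn with probability `q x y`, and the
players win if their answer bits satisfy `a ⊕ b = f x y`. -/
structure XORGame (mA mB : ℕ) where
  q : Fin mA → Fin mB → ℝ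
  q_nonneg : ∀ x y, 0 ≤ q x y
  q_sum : ∑ x, ∑ y, q x y = 1
  f : Fin mA → Fin mB → Fin 2

/-- The Bell functional of an XOR game: `B · P` is the winning probability
`∑ x y, q x y * P(a ⊕ b = f x y | x, y)`. Addition in `Fin 2` is modulo 2. -/
def XORGame.bell {mA mB : ℕ} (G : XORGame mA mB) : (BellScenario.binary mA mB).Box :=
  fun e =>
    let a : Fin 2 := e.1.2
    let b : Fin 2 := e.2.2
    if a + b = G.f e.1.1 e.2.1 then G.q e.1.1 e.2.1 else 0

end

noncomputable section

open scoped Matrix Kronecker ComplexOrder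

/-! ### Extension of positive functionals on matrices -/

/-! (1) Suppose a facet inequality of the classical polytope holds on the quantum set. Equality of
the two values makes it hold on the almost quantum set. Let `l s ≥ 0` be its slack at a pair `s` of
deterministic strategies. Signed combinations `c` of pairs `(s, s')` have moment matrices; those
that respect the zero products and are positive semidefinite are certificates up to scaling, so `c ↦
∑ c s s' * l s'` is nonnegative on them. Riesz extension (`exists_matrixPairing_extension`) yields a
dual positive semidefinite form `β` with diagonal `l`. Its rows at saturating strategies vanish and
its columns are affine in the deterministic box, so, the face being a facet, every column is a
multiple of `l`. Hence `β = κ l lᵀ` (`exists_slack_factorization`): formally `l = κ l²`, so `κ l`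
behaves like a projection.

Testing this identity on variations of strategies shows that certain products of variations vanish
(`exists_isProjectionLike`). This forces a wiring: one party's answer to a fixed input selects an
input of the other party, and `l` depends on these two answers only (`exists_pivot`,
`exists_wiring`). A nonnegative wiring is a nonnegative combination of entries of the box, so the
inequality holds on the whole no-signalling polytope. That polytope has the affine hull of the
classical one, so the inequality supports a no-signalling facet and is not proper.

(2) If an XOR game has no quantum advantage, Tsirelson's construction bounds its correlator
functional on all Gram matrices of constant diagonal. The same duality gives a positive semidefinite
form annihilating every optimal sign vector (`exists_marginal_equations`): linear equations in
marginals, hence odd under flipping all answers. On a facet such an equation is proportional to the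
slack, which is even, so it holds identically and all weights vanish. -/

open scoped MatrixOrder Matrix.Norms.L2Operator in
/-- A real positive semidefinite matrix is a Gram matrix. -/
lemma Matrix.PosSemidef.exists_eq_transpose_mul {n : Type*} [Fintype n] [DecidableEq n]
    {A : Matrix n n ℝ} (hA : A.PosSemidef) : ∃ B : Matrix n n ℝ, A = Bᵀ * B := by
  obtain ⟨B, hB⟩ := CStarAlgebra.nonneg_iff_eq_star_mul_self.mp hA.nonneg
  exact ⟨B, by simpa [Matrix.star_eq_conjTranspose] using hB⟩

/-- The functional `c ↦ ∑ i j, c i j * φ i j` on matrices. -/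
def matrixPairing {T : Type*} [Fintype T] (φ : Matrix T T ℝ) : Matrix T T ℝ →ₗ[ℝ] ℝ where
  toFun c := ∑ i, ∑ j, c i j * φ i j
  map_add' c d := by simp [add_mul, Finset.sum_add_distrib]
  map_smul' r c := by simp [mul_assoc, Finset.mul_sum]

section MatrixPairing

variable {T : Type*} [Fintype T]

lemma matrixPairing_apply (φ c : Matrix T T ℝ) :
    matrixPairing φ c = ∑ i, ∑ j, c i j * φ i j := rfl

lemma matrixPairing_transpose (φ c : Matrix T T ℝ) :
    matrixPairing φ cᵀ = matrixPairing φᵀ c := by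
  simp only [matrixPairing_apply, Matrix.transpose_apply]
  rw [Finset.sum_comm]

lemma matrixPairing_vecMulVec (φ : Matrix T T ℝ) (u w : T → ℝ) :
    matrixPairing φ (Matrix.vecMulVec u w) = u ⬝ᵥ φ *ᵥ w := by
  simp only [matrixPairing_apply, Matrix.vecMulVec_apply, dotProduct, Matrix.mulVec,
    Finset.mul_sum]
  exact Finset.sum_congr rfl fun i _ => Finset.sum_congr rfl fun j _ => by ring

/-- Matrices whose quadratic form is nonnegative at the vectors of `K`. -/
def nonnegOnCone (K : Set (T → ℝ)) : PointedCone ℝ (Matrix T T ℝ) where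
  carrier := {c | ∀ u ∈ K, 0 ≤ matrixPairing (Matrix.vecMulVec u u) c}
  add_mem' hc hd u hu := by
    rw [map_add]; exact add_nonneg (hc u hu) (hd u hu)
  zero_mem' u _ := by rw [map_zero]
  smul_mem' r c hc u hu := by
    change 0 ≤ matrixPairing (Matrix.vecMulVec u u) ((r : ℝ) • c)
    rw [map_smul]; exact mul_nonneg r.2 (hc u hu)

lemma transpose_mem_nonnegOnCone {K : Set (T → ℝ)} {c : Matrix T T ℝ}
    (hc : c ∈ nonnegOnCone K) : cᵀ ∈ nonnegOnCone K := fun u hu => by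
  rw [matrixPairing_transpose, Matrix.transpose_vecMulVec]; exact hc u hu

/-- The kernel of a form that is nonnegative on `nonnegOnCone K`. -/
lemma mulVec_eq_zero_of_nonnegOnCone {K : Set (T → ℝ)} {β : Matrix T T ℝ} (hβ : βᵀ = β)
    (h : ∀ c ∈ nonnegOnCone K, 0 ≤ matrixPairing β c) {u : T → ℝ} (hu : u ⬝ᵥ β *ᵥ u = 0) :
    β *ᵥ u = 0 := by
  have hps : β.PosSemidef := by
    refine .of_dotProduct_mulVec_nonneg (by simpa [Matrix.IsHermitian] using hβ) fun x => ?_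
    rw [star_trivial, ← matrixPairing_vecMulVec]
    -- Every square `x xᵀ` lies in the cone, whatever `K` is.
    refine h _ fun u _ => ?_
    rw [matrixPairing_vecMulVec, Matrix.vecMulVec_mulVec]
    simp only [op_smul_eq_smul, dotProduct_smul, smul_eq_mul]
    rw [dotProduct_comm]
    exact mul_self_nonneg _
  simpa using (hps.dotProduct_mulVec_zero_iff u).1 (by simpa using hu)

/-- Both `u uᵀ` and `-u uᵀ` lie in the cone, so the form vanishes at `u`. -/
lemma mulVec_eq_zero_of_forall_dotProduct_eq_zero {K : Set (T → ℝ)} {β : Matrix T T ℝ}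
    (hβ : βᵀ = β) (h : ∀ c ∈ nonnegOnCone K, 0 ≤ matrixPairing β c) {u : T → ℝ}
    (hu : ∀ v ∈ K, v ⬝ᵥ u = 0) : β *ᵥ u = 0 := by
  refine mulVec_eq_zero_of_nonnegOnCone hβ h (le_antisymm ?_ ?_)
  · have := h (-Matrix.vecMulVec u u) fun v hv => by
      rw [map_neg, matrixPairing_vecMulVec, Matrix.vecMulVec_mulVec, hu v hv]; simp
    rw [map_neg, matrixPairing_vecMulVec] at this
    linarith
  · have := h (Matrix.vecMulVec u u) fun v hv => by
      rw [matrixPairing_vecMulVec, Matrix.vecMulVec_mulVec, hu v hv]; simp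
    rwa [matrixPairing_vecMulVec] at this

variable [DecidableEq T]

/-- The identity is an order unit, which is the domination hypothesis of the Riesz extension
theorem. -/
lemma exists_smul_one_add_mem_nonnegOnCone (K : Set (T → ℝ)) (c : Matrix T T ℝ) :
    ∃ t : ℝ, t • (1 : Matrix T T ℝ) + c ∈ nonnegOnCone K := by
  refine ⟨∑ i, ∑ j, |c i j|, fun u _ => ?_⟩
  rw [map_add, map_smul]
  have h1 : matrixPairing (Matrix.vecMulVec u u) 1 = ∑ k, u k ^ 2 := by
    simp [matrixPairing_apply, Matrix.one_apply, Matrix.vecMulVec_apply, sq]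
  have h2 : -((∑ i, ∑ j, |c i j|) * ∑ k, u k ^ 2) ≤ matrixPairing (Matrix.vecMulVec u u) c := by
    rw [matrixPairing_apply, Finset.sum_mul, ← Finset.sum_neg_distrib]
    refine Finset.sum_le_sum fun i _ => ?_
    rw [Finset.sum_mul, ← Finset.sum_neg_distrib]
    refine Finset.sum_le_sum fun j _ => ?_
    have hi : u i ^ 2 ≤ ∑ k, u k ^ 2 :=
      Finset.single_le_sum (fun k _ => sq_nonneg (u k)) (Finset.mem_univ i)
    have hj : u j ^ 2 ≤ ∑ k, u k ^ 2 :=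
      Finset.single_le_sum (fun k _ => sq_nonneg (u k)) (Finset.mem_univ j)
    have hij : |u i * u j| ≤ ∑ k, u k ^ 2 := by
      rw [abs_le]
      constructor <;> nlinarith [sq_nonneg (u i - u j), sq_nonneg (u i + u j)]
    rw [Matrix.vecMulVec_apply]
    refine le_trans (neg_le_neg ?_) (neg_abs_le _)
    rw [abs_mul]
    exact mul_le_mul_of_nonneg_left hij (abs_nonneg _)
  rw [h1, smul_eq_mul]
  linarith

/-- A functional which is nonnegative at the matrices of a subspace `p ∋ 1` of symmetric matrices
with nonnegative quadratic form on `K` extends from `p` to a functional that is nonnegative at all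
matrices with nonnegative quadratic form on `K`. -/
lemma exists_matrixPairing_extension (K : Set (T → ℝ)) (p : Submodule ℝ (Matrix T T ℝ))
    (hp : ∀ c ∈ p, cᵀ = c) (h1 : (1 : Matrix T T ℝ) ∈ p) (φ : Matrix T T ℝ)
    (hφ : ∀ c ∈ p, c ∈ nonnegOnCone K → 0 ≤ matrixPairing φ c) :
    ∃ β : Matrix T T ℝ, βᵀ = β ∧ (∀ c ∈ p, matrixPairing β c = matrixPairing φ c) ∧
      ∀ c ∈ nonnegOnCone K, 0 ≤ matrixPairing β c := by
  obtain ⟨g, hg, hg0⟩ := riesz_extension (nonnegOnCone K) ⟨p, (matrixPairing φ).comp p.subtype⟩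
    (fun x hx => hφ x x.2 hx) (fun y => by
      obtain ⟨t, ht⟩ := exists_smul_one_add_mem_nonnegOnCone K y
      exact ⟨⟨t • 1, p.smul_mem t h1⟩, ht⟩)
  have hgp : ∀ c ∈ p, g c = matrixPairing φ c := fun c hc => hg ⟨c, hc⟩
  set γ : Matrix T T ℝ := Matrix.of fun i j => g (Matrix.single i j 1) with hγ
  have hγg : ∀ c, matrixPairing γ c = g c := fun c => by
    conv_rhs => rw [Matrix.matrix_eq_sum_single c]
    simp only [map_sum, matrixPairing_apply, hγ, Matrix.of_apply]
    refine Finset.sum_congr rfl fun i _ => Finset.sum_congr rfl fun j _ => ?_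
    rw [← smul_eq_mul, ← map_smul, Matrix.smul_single, smul_eq_mul, mul_one]
  -- The extension need not be symmetric. Averaging with the transpose preserves its values on `p`
  -- and its positivity, because the cone is stable under transposition.
  have key : ∀ c, matrixPairing ((1 / 2 : ℝ) • (γ + γᵀ)) c = (g c + g cᵀ) / 2 := fun c => by
    rw [← hγg, ← hγg, matrixPairing_transpose]
    simp only [matrixPairing_apply, ← Finset.sum_add_distrib, Finset.sum_div]
    refine Finset.sum_congr rfl fun i _ => Finset.sum_congr rfl fun j _ => ?_
    simp only [Matrix.smul_apply, Matrix.add_apply, smul_eq_mul]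
    ring
  refine ⟨(1 / 2 : ℝ) • (γ + γᵀ), ?_, fun c hc => ?_, fun c hc => ?_⟩
  · simp [add_comm]
  · rw [key, hp c hc, hgp c hc]; ring
  · rw [key]
    have := hg0 c hc
    have := hg0 _ (transpose_mem_nonnegOnCone hc)
    positivity

end MatrixPairing

namespace BellScenario

/-! ### Facets -/

section Facets

variable {S : BellScenario} {K : Set S.Box} {B : S.Box} {ω : ℝ}

lemma IsFacet.exists_lt (h : IsFacet K B ω) : ∃ P ∈ K, B ⬝ᵥ P < ω := by
  by_contra! hK
  have : {P ∈ K | B ⬝ᵥ P = ω} = K :=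
    Set.sep_eq_self_iff_mem_true.2 fun P hP => le_antisymm (h.valid P hP) (hK P hP)
  have h2 := h.finrank_add_one
  rw [this] at h2
  omega

lemma vectorSpan_le_ker_dotProduct {F : Set S.Box} {v : S.Box} {t : ℝ}
    (h : ∀ P ∈ F, v ⬝ᵥ P = t) : vectorSpan ℝ F ≤ LinearMap.ker (dotProductBilin ℝ ℝ v) := by
  refine Submodule.span_le.2 ?_
  rintro _ ⟨P, hP, Q, hQ, rfl⟩
  simp [dotProduct_sub, h P hP, h Q hQ]

/-- An affine functional that vanishes on a facet is proportional to the functional of the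
facet. -/
lemma IsFacet.mul_eq_mul (h : IsFacet K B ω) {v : S.Box} {k : ℝ}
    (hv : ∀ P ∈ K, B ⬝ᵥ P = ω → k + v ⬝ᵥ P = 0) {D D' : S.Box} (hD : D ∈ K) (hD' : D' ∈ K) :
    (k + v ⬝ᵥ D) * (ω - B ⬝ᵥ D') = (k + v ⬝ᵥ D') * (ω - B ⬝ᵥ D) := by
  obtain ⟨P₀, hP₀, hP₀ω⟩ := h.nonempty
  by_cases hω : B ⬝ᵥ D' = ω
  · rw [hv D' hD' hω, hω]; ring
  set H := vectorSpan ℝ {P ∈ K | B ⬝ᵥ P = ω} with hH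
  have hHB : H ≤ LinearMap.ker (dotProductBilin ℝ ℝ B) :=
    vectorSpan_le_ker_dotProduct fun P hP => hP.2
  have hHv : H ≤ LinearMap.ker (dotProductBilin ℝ ℝ v) :=
    vectorSpan_le_ker_dotProduct (t := -k) fun P hP => by linarith [hv P hP.1 hP.2]
  have hnot : D' - P₀ ∉ H := fun hmem => hω <| by
    have : B ⬝ᵥ (D' - P₀) = 0 := hHB hmem
    rw [dotProduct_sub, hP₀ω] at this
    linarith
  have hlt : H < H ⊔ Submodule.span ℝ {D' - P₀} :=
    lt_of_le_of_ne le_sup_left fun heq => hnot <| by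
      rw [heq]; exact Submodule.mem_sup_right (Submodule.mem_span_singleton_self _)
  have hle : H ⊔ Submodule.span ℝ {D' - P₀} ≤ vectorSpan ℝ K := by
    refine sup_le (vectorSpan_mono ℝ (Set.sep_subset _ _)) ?_
    rw [Submodule.span_singleton_le_iff_mem]
    exact vsub_mem_vectorSpan ℝ hD' hP₀
  have heq : H ⊔ Submodule.span ℝ {D' - P₀} = vectorSpan ℝ K := by
    refine Submodule.eq_of_le_of_finrank_le hle ?_
    have := Submodule.finrank_lt_finrank_of_lt hlt
    have := h.finrank_add_one
    rw [← hH] at this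
    omega
  -- The directions of `K` are those of the face plus one line. Both functionals vanish on the
  -- former, so both scale by the same `t`.
  have hmem : D - P₀ ∈ H ⊔ Submodule.span ℝ {D' - P₀} := heq ▸ vsub_mem_vectorSpan ℝ hD hP₀
  obtain ⟨y, hy, z, hz, hyz⟩ := Submodule.mem_sup.1 hmem
  obtain ⟨t, rfl⟩ := Submodule.mem_span_singleton.1 hz
  have hBy : B ⬝ᵥ y = 0 := hHB hy
  have hvy : v ⬝ᵥ y = 0 := hHv hy
  have hv0 := hv P₀ hP₀ hP₀ω
  have e1 : B ⬝ᵥ D - ω = t * (B ⬝ᵥ D' - ω) := by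
    have := congrArg (B ⬝ᵥ ·) hyz
    simp only [dotProduct_add, dotProduct_smul, dotProduct_sub, smul_eq_mul, hBy, hP₀ω] at this
    linarith
  have e2 : k + v ⬝ᵥ D = t * (k + v ⬝ᵥ D') := by
    have := congrArg (v ⬝ᵥ ·) hyz
    simp only [dotProduct_add, dotProduct_smul, dotProduct_sub, smul_eq_mul, hvy] at this
    linear_combination -this + (1 - t) * hv0
  linear_combination (ω - B ⬝ᵥ D') * e2 + (k + v ⬝ᵥ D') * e1

/-- A convex combination with positive weights reaches the bound only if both of its points do, so
equations on a face may be checked at generators. -/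
lemma dotProduct_eq_zero_of_mem_convexHull {s : Set S.Box} (hs : ∀ P ∈ s, B ⬝ᵥ P ≤ ω)
    {v : S.Box} {k : ℝ} (hv : ∀ P ∈ s, B ⬝ᵥ P = ω → k + v ⬝ᵥ P = 0) :
    ∀ P ∈ convexHull ℝ s, B ⬝ᵥ P = ω → k + v ⬝ᵥ P = 0 := by
  suffices convexHull ℝ s ⊆ {P | B ⬝ᵥ P ≤ ω ∧ (B ⬝ᵥ P = ω → k + v ⬝ᵥ P = 0)} from
    fun P hP => (this hP).2
  refine convexHull_min (fun P hP => ⟨hs P hP, hv P hP⟩) (convex_iff_forall_pos.2 ?_)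
  rintro P ⟨hP, hP'⟩ Q ⟨hQ, hQ'⟩ a b ha hb hab
  have hb' : b = 1 - a := by linarith
  simp only [Set.mem_ofPred_eq, dotProduct_add, dotProduct_smul, smul_eq_mul]
  have h1 := mul_le_mul_of_nonneg_left hP ha.le
  have h2 := mul_le_mul_of_nonneg_left hQ hb.le
  have h3 : a * ω + b * ω = ω := by rw [← add_mul, hab, one_mul]
  refine ⟨by linarith, fun heq => ?_⟩
  have h4 : B ⬝ᵥ P = ω := mul_left_cancel₀ ha.ne' (by linarith)
  have h5 : B ⬝ᵥ Q = ω := mul_left_cancel₀ hb.ne' (by linarith)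
  subst hb'
  linear_combination a * hP' h4 + (1 - a) * hQ' h5

lemma IsFacet.exists_mul_eq {s : Set S.Box} (h : IsFacet (convexHull ℝ s) B ω) {v : S.Box} {k : ℝ}
    (hv : ∀ P ∈ s, B ⬝ᵥ P = ω → k + v ⬝ᵥ P = 0) :
    ∃ c, ∀ P ∈ s, k + v ⬝ᵥ P = c * (ω - B ⬝ᵥ P) := by
  obtain ⟨D, hD, hlt⟩ := h.exists_lt
  have hv' := dotProduct_eq_zero_of_mem_convexHull
    (fun P hP => h.valid P (subset_convexHull ℝ s hP)) hv
  have hne : ω - B ⬝ᵥ D ≠ 0 := by linarith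
  refine ⟨(k + v ⬝ᵥ D) / (ω - B ⬝ᵥ D), fun P hP => ?_⟩
  rw [div_mul_eq_mul_div, eq_div_iff hne]
  exact h.mul_eq_mul hv' (subset_convexHull ℝ s hP) hD

/-- A facet inequality of `C` that is valid on a set `K` between `C` and its affine hull supports
a facet of `K`. -/
lemma IsFacet.of_subset {C : Set S.Box} (h : IsFacet C B ω) (hCK : C ⊆ K)
    (hK : K ⊆ affineSpan ℝ C) (hval : ∀ P ∈ K, B ⬝ᵥ P ≤ ω) : IsFacet K B ω := by
  obtain ⟨P₀, hP₀, hP₀ω⟩ := h.nonempty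
  obtain ⟨D, hD, hlt⟩ := h.exists_lt
  refine ⟨hval, ⟨P₀, hCK hP₀, hP₀ω⟩, ?_⟩
  have hspan : vectorSpan ℝ K = vectorSpan ℝ C := by
    have : affineSpan ℝ K = affineSpan ℝ C :=
      le_antisymm (affineSpan_le.2 hK) (affineSpan_mono ℝ hCK)
    rw [← direction_affineSpan, this, direction_affineSpan]
  have h1 : Module.finrank ℝ (vectorSpan ℝ {P ∈ C | B ⬝ᵥ P = ω}) ≤
      Module.finrank ℝ (vectorSpan ℝ {P ∈ K | B ⬝ᵥ P = ω}) :=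
    Submodule.finrank_mono (vectorSpan_mono ℝ fun P hP => ⟨hCK hP.1, hP.2⟩)
  have h2 : Module.finrank ℝ (vectorSpan ℝ {P ∈ K | B ⬝ᵥ P = ω}) <
      Module.finrank ℝ (vectorSpan ℝ K) := by
    refine Submodule.finrank_lt_finrank_of_lt
      (lt_of_le_of_ne (vectorSpan_mono ℝ (Set.sep_subset _ _)) fun heq => ?_)
    have hmem : D - P₀ ∈ vectorSpan ℝ {P ∈ K | B ⬝ᵥ P = ω} := by
      rw [heq]; exact vsub_mem_vectorSpan ℝ (hCK hD) (hCK hP₀)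
    have : B ⬝ᵥ (D - P₀) = 0 := vectorSpan_le_ker_dotProduct (fun P hP => hP.2) hmem
    rw [dotProduct_sub] at this
    linarith
  have := h.finrank_add_one
  rw [hspan] at h2 ⊢
  omega

end Facets

/-! ### Deterministic strategies -/

/-- The deterministic behaviour of one party that answers `f x` to the input `x`. -/
def response {m : ℕ} {d : Fin m → ℕ} (f : ∀ x, Fin (d x)) (k : Σ x : Fin m, Fin (d x)) : ℝ :=
  if f k.1 = k.2 then 1 else 0

section Response

variable {m : ℕ} {d : Fin m → ℕ} (f : ∀ x, Fin (d x))

lemma sum_response_mul (x : Fin m) (c : Fin (d x) → ℝ) :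
    ∑ a, response f ⟨x, a⟩ * c a = c (f x) := by
  simp [response]

lemma sum_response (x : Fin m) : ∑ a, response f ⟨x, a⟩ = 1 := by
  simp [response]

/-- A vector-valued function on the letters whose sum over the outputs of an input does not depend
on the input is a combination of deterministic behaviours. -/
lemma eq_sum_response_smul {V : Type*} [AddCommGroup V] [Module ℝ V]
    (g : (Σ x : Fin m, Fin (d x)) → V) (N : V) (hg : ∀ x, ∑ a, g ⟨x, a⟩ = N)
    (k : Σ x : Fin m, Fin (d x)) :
    g k = ∑ x, ∑ a, response (Function.update f x a) k • g ⟨x, a⟩ -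
      ((m : ℝ) - 1) • response f k • N := by
  obtain ⟨x', a'⟩ := k
  -- Updating an input other than `x'` leaves the answer at `x'` alone, so each such `x` contributes
  -- the same term `response f • N`; the `m - 1` copies are subtracted.
  have h1 : ∀ x, ∑ a, response (Function.update f x a) ⟨x', a'⟩ • g ⟨x, a⟩ =
      response f ⟨x', a'⟩ • N +
        if x = x' then g ⟨x', a'⟩ - response f ⟨x', a'⟩ • N else 0 := fun x => by
    by_cases hx : x = x'
    · subst hx
      simp [response]
    · simp [response, Function.update_of_ne (Ne.symm hx), hx, hg]
  simp only [h1, Finset.sum_add_distrib, Finset.sum_ite_eq', Finset.mem_univ, if_true,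
    Finset.sum_const, Finset.card_univ, Fintype.card_fin]
  rw [sub_smul, one_smul, Nat.cast_smul_eq_nsmul]
  abel

end Response

/-- Pairs of deterministic strategies of Alice and Bob. -/
abbrev Strategy (S : BellScenario) : Type := (∀ x, Fin (S.dA x)) × (∀ y, Fin (S.dB y))

/-- The local deterministic box of a pair of deterministic strategies. -/
def detBox (S : BellScenario) (s : S.Strategy) : S.Box :=
  fun e => response s.1 e.1 * response s.2 e.2

variable {S : BellScenario}

lemma dotProduct_detBox (v : S.Box) (s : S.Strategy) :
    v ⬝ᵥ S.detBox s = ∑ x, ∑ y, v (⟨x, s.1 x⟩, ⟨y, s.2 y⟩) := by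
  simp only [dotProduct, Fintype.sum_prod_type, Fintype.sum_sigma]
  refine Finset.sum_congr rfl fun x _ => ?_
  rw [Finset.sum_comm]
  refine Finset.sum_congr rfl fun y _ => ?_
  simp [detBox, response]

lemma detBox_isNoSignalling (s : S.Strategy) : S.IsNoSignalling (S.detBox s) where
  nonneg e := by
    unfold detBox response
    positivity
  normalized x y := by
    simp only [detBox, ← Finset.mul_sum, sum_response, mul_one]
  noSignallingAtoB x x' y b := by
    simp only [detBox, ← Finset.sum_mul, sum_response]
  noSignallingBtoA y y' x a := by
    simp only [detBox, ← Finset.mul_sum, sum_response]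

lemma detBox_mem_localDeterministic (s : S.Strategy) : S.detBox s ∈ S.localDeterministic :=
  ⟨detBox_isNoSignalling s, fun e => by unfold detBox response; split_ifs <;> simp⟩

/-- No-signalling keeps the certain answer of one party from depending on the other party's input.
-/
lemma exists_detBox_eq (hA : 0 < S.mA) (hB : 0 < S.mB) {P : S.Box}
    (hP : P ∈ S.localDeterministic) : ∃ s, S.detBox s = P := by
  obtain ⟨hNS, h01⟩ := hP
  let x₀ : Fin S.mA := ⟨0, hA⟩
  let y₀ : Fin S.mB := ⟨0, hB⟩
  have hex : ∀ x y, ∃ a b, P (⟨x, a⟩, ⟨y, b⟩) = 1 := fun x y => by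
    by_contra! hne
    have := hNS.normalized x y
    rw [Finset.sum_eq_zero fun a _ => Finset.sum_eq_zero fun b _ =>
      (h01 (⟨x, a⟩, ⟨y, b⟩)).resolve_right (hne a b)] at this
    exact zero_ne_one this
  have huniqA : ∀ x y y' a a' b b', P (⟨x, a⟩, ⟨y, b⟩) = 1 → P (⟨x, a'⟩, ⟨y', b'⟩) = 1 →
      a = a' := fun x y y' a a' b b' h h' => by
    by_contra hne
    have h1 : 1 ≤ ∑ b, P (⟨x, a⟩, ⟨y, b⟩) := h ▸
      Finset.single_le_sum (f := fun b => P (⟨x, a⟩, ⟨y, b⟩)) (fun _ _ => hNS.nonneg _)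
        (Finset.mem_univ b)
    have h2 : 1 ≤ ∑ b, P (⟨x, a'⟩, ⟨y, b⟩) := by
      rw [hNS.noSignallingBtoA y y' x a', ← h']
      exact Finset.single_le_sum (f := fun b => P (⟨x, a'⟩, ⟨y', b⟩)) (fun _ _ => hNS.nonneg _)
        (Finset.mem_univ b')
    have h3 := Finset.add_le_sum (f := fun a => ∑ b, P (⟨x, a⟩, ⟨y, b⟩))
      (fun a _ => Finset.sum_nonneg fun b _ => hNS.nonneg _) (Finset.mem_univ a)
      (Finset.mem_univ a') hne
    rw [hNS.normalized] at h3
    linarith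
  have huniqB : ∀ y x x' b b' a a', P (⟨x, a⟩, ⟨y, b⟩) = 1 → P (⟨x', a'⟩, ⟨y, b'⟩) = 1 →
      b = b' := fun y x x' b b' a a' h h' => by
    by_contra hne
    have h1 : 1 ≤ ∑ a, P (⟨x, a⟩, ⟨y, b⟩) := h ▸
      Finset.single_le_sum (f := fun a => P (⟨x, a⟩, ⟨y, b⟩)) (fun _ _ => hNS.nonneg _)
        (Finset.mem_univ a)
    have h2 : 1 ≤ ∑ a, P (⟨x, a⟩, ⟨y, b'⟩) := by
      rw [hNS.noSignallingAtoB x x' y b', ← h']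
      exact Finset.single_le_sum (f := fun a => P (⟨x', a⟩, ⟨y, b'⟩)) (fun _ _ => hNS.nonneg _)
        (Finset.mem_univ a')
    have h3 := Finset.add_le_sum (f := fun b => ∑ a, P (⟨x, a⟩, ⟨y, b⟩))
      (fun b _ => Finset.sum_nonneg fun a _ => hNS.nonneg _) (Finset.mem_univ b)
      (Finset.mem_univ b') hne
    rw [Finset.sum_comm, hNS.normalized] at h3
    linarith
  choose f b hf using fun x => hex x y₀
  choose a h hh using fun y => hex x₀ y
  refine ⟨(f, h), ?_⟩
  ext ⟨⟨x, a'⟩, ⟨y, b'⟩⟩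
  obtain ⟨a₁, b₁, h1⟩ := hex x y
  have ha₁ : f x = a₁ := huniqA _ _ _ _ _ _ _ (hf x) h1
  have hb₁ : h y = b₁ := huniqB _ _ _ _ _ _ _ (hh y) h1
  by_cases hab : f x = a' ∧ h y = b'
  · obtain ⟨rfl, rfl⟩ := hab
    rw [ha₁, hb₁, h1]
    simp [detBox, response, ha₁, hb₁]
  · have h0 : P (⟨x, a'⟩, ⟨y, b'⟩) = 0 := (h01 _).resolve_right fun h1' =>
      hab ⟨huniqA _ _ _ _ _ _ _ (hf x) h1', huniqB _ _ _ _ _ _ _ (hh y) h1'⟩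
    rw [h0]
    by_cases h2 : f x = a'
    · have h3 : h y ≠ b' := fun h3 => hab ⟨h2, h3⟩
      simp [detBox, response, h3]
    · simp [detBox, response, h2]

lemma localDeterministic_eq_range (hA : 0 < S.mA) (hB : 0 < S.mB) :
    S.localDeterministic = Set.range S.detBox :=
  Set.Subset.antisymm (fun _ hP => exists_detBox_eq hA hB hP)
    (Set.range_subset_iff.2 detBox_mem_localDeterministic)

/-- Without inputs on one side the space of boxes is trivial, and the dimension condition would read
`0 + 1 = 0`. -/
lemma mA_pos_mB_pos_of_isFacet {K : Set S.Box} {B : S.Box} {ω : ℝ} (h : IsFacet K B ω) :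
    0 < S.mA ∧ 0 < S.mB := by
  by_contra hne
  have : IsEmpty S.Event := by
    rw [not_and_or, Nat.not_lt, Nat.not_lt, Nat.le_zero, Nat.le_zero] at hne
    refine ⟨fun e => ?_⟩
    rcases hne with h0 | h0
    · exact (finCongr h0 e.1.1).elim0
    · exact (finCongr h0 e.2.1).elim0
  have h1 := h.finrank_add_one
  rw [Module.finrank_zero_of_subsingleton, Module.finrank_zero_of_subsingleton] at h1
  omega

/-- Every no-signalling box is an affine combination of local deterministic boxes. -/
lemma IsNoSignalling.exists_sum_smul_detBox (hA : 0 < S.mA) (hB : 0 < S.mB) {P : S.Box}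
    (hP : S.IsNoSignalling P) :
    ∃ w : S.Strategy → ℝ, ∑ s, w s = 1 ∧ P = ∑ s, w s • S.detBox s := by
  let x₀ : Fin S.mA := ⟨0, hA⟩
  let y₀ : Fin S.mB := ⟨0, hB⟩
  have hdA : ∀ x, Nonempty (Fin (S.dA x)) := fun x => by
    by_contra hne
    rw [not_nonempty_iff] at hne
    simpa using hP.normalized x y₀
  have hdB : ∀ y, Nonempty (Fin (S.dB y)) := fun y => by
    by_contra hne
    rw [not_nonempty_iff] at hne
    simpa using hP.normalized x₀ y
  let f₀ : ∀ x, Fin (S.dA x) := fun x => Classical.arbitrary _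
  let h₀ : ∀ y, Fin (S.dB y) := fun y => Classical.arbitrary _
  have hone : ∀ (f : ∀ x, Fin (S.dA x)) (q : S.LetterB → ℝ) (N : ℝ),
      (∀ y, ∑ b, q ⟨y, b⟩ = N) →
      (fun e : S.Event => response f e.1 * q e.2) ∈
        Submodule.span ℝ (Set.range S.detBox) := fun f q N hq => by
    have : (fun e : S.Event => response f e.1 * q e.2) =
        ∑ y, ∑ b, q ⟨y, b⟩ • S.detBox (f, Function.update h₀ y b) -
          (((S.mB : ℝ) - 1) * N) • S.detBox (f, h₀) := by
      ext e
      simp only [Pi.sub_apply, Finset.sum_apply, Pi.smul_apply, smul_eq_mul, detBox]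
      conv_lhs => rw [eq_sum_response_smul h₀ q N hq e.2]
      simp only [mul_sub, Finset.mul_sum, smul_eq_mul]
      congr 1
      · exact Finset.sum_congr rfl fun y _ => Finset.sum_congr rfl fun b _ => by ring
      · ring
    rw [this]
    exact sub_mem (sum_mem fun y _ => sum_mem fun b _ => Submodule.smul_mem _ _
      (Submodule.subset_span ⟨_, rfl⟩)) (Submodule.smul_mem _ _ (Submodule.subset_span ⟨_, rfl⟩))
  -- The one-party decomposition is used twice: here for Alice, with Bob's unnormalized behaviours
  -- as values, and in `hone` for Bob.
  have hmem : P ∈ Submodule.span ℝ (Set.range S.detBox) := by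
    have : P = ∑ x, ∑ a, (fun e : S.Event =>
        response (Function.update f₀ x a) e.1 * P (⟨x, a⟩, e.2)) -
        ((S.mA : ℝ) - 1) • fun e : S.Event => response f₀ e.1 * ∑ a, P (⟨x₀, a⟩, e.2) := by
      ext ⟨k, l⟩
      have := congrFun (eq_sum_response_smul f₀ (fun k l => P (k, l))
        (fun l => ∑ a, P (⟨x₀, a⟩, l)) (fun x => by
          ext ⟨y, b⟩
          simpa using hP.noSignallingAtoB x x₀ y b) k) l
      simpa using this
    rw [this]
    refine sub_mem (sum_mem fun x _ => sum_mem fun a _ => ?_) (Submodule.smul_mem _ _ ?_)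
    · exact hone _ (fun l => P (⟨x, a⟩, l)) (∑ b, P (⟨x, a⟩, ⟨y₀, b⟩))
        fun y => hP.noSignallingBtoA y y₀ x a
    · refine hone _ (fun l => ∑ a, P (⟨x₀, a⟩, l)) 1 fun y => ?_
      rw [Finset.sum_comm]
      exact hP.normalized x₀ y
  obtain ⟨w, hw⟩ := (Submodule.mem_span_range_iff_exists_fun ℝ).1 hmem
  refine ⟨w, ?_, hw.symm⟩
  -- Normalization at a single pair of inputs already forces the weights to sum to 1.
  have h1 := hP.normalized x₀ y₀
  rw [← hw] at h1
  simp only [Finset.sum_apply, Pi.smul_apply, smul_eq_mul] at h1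
  rw [Finset.sum_congr rfl fun a _ => Finset.sum_comm, Finset.sum_comm] at h1
  rw [← h1]
  refine Finset.sum_congr rfl fun s _ => ?_
  simp only [← Finset.mul_sum]
  rw [(detBox_isNoSignalling s).normalized, mul_one]

lemma classical_subset_noSignalling : S.classical ⊆ S.noSignalling := by
  refine convexHull_min (fun P hP => hP.1) ?_
  intro P hP Q hQ a b ha hb hab
  refine ⟨fun e => ?_, fun x y => ?_, fun x x' y b' => ?_, fun y y' x a' => ?_⟩ <;>
    simp only [Pi.add_apply, Pi.smul_apply, smul_eq_mul, Finset.sum_add_distrib, ← Finset.mul_sum]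
  · exact add_nonneg (mul_nonneg ha (hP.nonneg e)) (mul_nonneg hb (hQ.nonneg e))
  · rw [hP.normalized, hQ.normalized]; linarith
  · rw [hP.noSignallingAtoB x x', hQ.noSignallingAtoB x x']
  · rw [hP.noSignallingBtoA y y', hQ.noSignallingBtoA y y']

lemma noSignalling_subset_affineSpan_classical (hA : 0 < S.mA) (hB : 0 < S.mB) :
    S.noSignalling ⊆ affineSpan ℝ S.classical := fun P hP => by
  obtain ⟨w, hw, rfl⟩ := IsNoSignalling.exists_sum_smul_detBox hA hB hP
  rw [← Finset.affineCombination_eq_linear_combination _ _ _ hw]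
  refine affineSpan_mono ℝ ?_ (affineCombination_mem_affineSpan hw S.detBox)
  exact Set.range_subset_iff.2 fun s => subset_convexHull ℝ _ (detBox_mem_localDeterministic s)

lemma IsNoSignalling.le_one {P : S.Box} (hP : S.IsNoSignalling P) (e : S.Event) : P e ≤ 1 := by
  obtain ⟨⟨x, a⟩, ⟨y, b⟩⟩ := e
  rw [← hP.normalized x y]
  exact (Finset.single_le_sum (f := fun b => P (⟨x, a⟩, ⟨y, b⟩)) (fun _ _ => hP.nonneg _)
    (Finset.mem_univ b)).trans (Finset.single_le_sum (f := fun a => ∑ b, P (⟨x, a⟩, ⟨y, b⟩))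
      (fun _ _ => Finset.sum_nonneg fun _ _ => hP.nonneg _) (Finset.mem_univ a))

lemma bddAbove_image_dotProduct {K : Set S.Box} (B : S.Box)
    (hK : ∀ P ∈ K, ∀ e, 0 ≤ P e ∧ P e ≤ 1) : BddAbove ((fun P => B ⬝ᵥ P) '' K) := by
  refine ⟨∑ e, |B e|, ?_⟩
  rintro _ ⟨P, hP, rfl⟩
  refine Finset.sum_le_sum fun e _ => ?_
  obtain ⟨h0, h1⟩ := hK P hP e
  calc B e * P e ≤ |B e| * P e := mul_le_mul_of_nonneg_right (le_abs_self _) h0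
    _ ≤ |B e| * 1 := mul_le_mul_of_nonneg_left h1 (abs_nonneg _)
    _ = |B e| := mul_one _

end BellScenario

/-! ### Quantum boxes -/

lemma Matrix.PosSemidef.trace_mul_nonneg_of_isIdempotentElem {n : Type*} [Fintype n]
    {ρ Q : Matrix n n ℂ} (hρ : ρ.PosSemidef) (hQ : Q.IsHermitian) (hQ' : Q * Q = Q) :
    0 ≤ (ρ * Q).trace := by
  have h := (hρ.mul_mul_conjTranspose_same Q).trace_nonneg
  rwa [Matrix.trace_mul_comm, ← Matrix.mul_assoc, hQ.eq, hQ', Matrix.trace_mul_comm] at h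

namespace BellScenario

variable {S : BellScenario}

lemma isHermitian_kronecker {m n : Type*} {A : Matrix m m ℂ} {B : Matrix n n ℂ}
    (hA : A.IsHermitian) (hB : B.IsHermitian) : (A ⊗ₖ B).IsHermitian := by
  rw [Matrix.IsHermitian, Matrix.conjTranspose_kronecker, hA.eq, hB.eq]

lemma IsProjectiveMeasurement.mul_self {m : ℕ} {d : Fin m → ℕ} {N : ℕ}
    {E : (Σ x : Fin m, Fin (d x)) → Matrix (Fin N) (Fin N) ℂ} (hE : IsProjectiveMeasurement E)
    (k : Σ x : Fin m, Fin (d x)) : E k * E k = E k := by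
  simpa using hE.orthogonal k.1 k.2 k.2

lemma mem_Icc_of_mem_quantum {P : S.Box} (hP : P ∈ S.quantum) (e : S.Event) :
    0 ≤ P e ∧ P e ≤ 1 := by
  obtain ⟨NA, NB, ρ, E, F, hρ, htr, hE, hF, h⟩ := hP
  obtain ⟨k, l⟩ := e
  have hH : (E k ⊗ₖ F l).IsHermitian := isHermitian_kronecker (hE.hermitian k) (hF.hermitian l)
  have hI : (E k ⊗ₖ F l) * (E k ⊗ₖ F l) = E k ⊗ₖ F l := by
    rw [← Matrix.mul_kronecker_mul, hE.mul_self, hF.mul_self]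
  have h0 := hρ.trace_mul_nonneg_of_isIdempotentElem hH hI
  have h1 := hρ.trace_mul_nonneg_of_isIdempotentElem (Q := 1 - E k ⊗ₖ F l)
    (Matrix.isHermitian_one.sub hH) (by
      rw [sub_mul, mul_sub, mul_sub, hI]; simp)
  rw [mul_sub, mul_one, Matrix.trace_sub, htr, ← h] at h1
  rw [← h] at h0
  constructor
  · exact_mod_cast h0
  · have : (0 : ℂ) ≤ ((1 - P (k, l) : ℝ) : ℂ) := by push_cast; exact h1
    have : (0 : ℝ) ≤ 1 - P (k, l) := by exact_mod_cast this
    linarith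

lemma isProjectiveMeasurement_response {m : ℕ} {d : Fin m → ℕ} (f : ∀ x, Fin (d x)) :
    IsProjectiveMeasurement fun k => ((response f k : ℝ) : ℂ) • (1 : Matrix (Fin 1) (Fin 1) ℂ) where
  hermitian k := by
    rw [Matrix.IsHermitian, Matrix.conjTranspose_smul, Matrix.conjTranspose_one]
    simp
  orthogonal x a a' := by
    by_cases h : a = a'
    · subst h
      by_cases h2 : f x = a <;> simp [response, h2]
    · by_cases h2 : f x = a
      · have h3 : f x ≠ a' := fun h3 => h (h2.symm.trans h3)
        simp [response, h, h3]
      · simp [response, h, h2]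
  complete x := by
    rw [← Finset.sum_smul, ← Complex.ofReal_sum, sum_response]
    simp

lemma detBox_mem_quantum (s : S.Strategy) : S.detBox s ∈ S.quantum :=
  ⟨1, 1, 1, _, _, Matrix.PosSemidef.one, by simp, isProjectiveMeasurement_response s.1,
    isProjectiveMeasurement_response s.2, fun k l => by
      simp [detBox, Matrix.smul_kronecker, Matrix.kronecker_smul, smul_smul, Matrix.trace_smul, mul_comm]⟩

end BellScenario

/-! ### Tsirelson's construction -/

/-- Linear families of Hermitian matrices with `C u * C u = ‖u‖²`. -/
lemma exists_clifford_fin (n : ℕ) :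
    ∃ (ι : Type) (_ : Fintype ι) (_ : DecidableEq ι) (_ : Nonempty ι)
      (C : (Fin n → ℝ) → Matrix ι ι ℂ), (∀ u, (C u).IsHermitian) ∧
      (∀ u, C u * C u = ((u ⬝ᵥ u : ℝ) : ℂ) • 1) ∧ ∀ u v, C (u + v) = C u + C v := by
  induction n with
  | zero =>
    exact ⟨Unit, inferInstance, inferInstance, inferInstance, fun _ => 0,
      fun _ => Matrix.isHermitian_zero, fun u => by simp, fun u v => by simp⟩
  | succ n ih =>
    obtain ⟨ι, _, _, _, C, hH, hsq, hadd⟩ := ih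
    refine ⟨ι ⊕ ι, inferInstance, inferInstance, inferInstance, fun u =>
      -- The Clifford recursion `σ_z ⊗ C (tail u) + u₀ σ_x ⊗ 1`; the two summands anticommute.
      Matrix.fromBlocks (C (Fin.tail u)) (((u 0 : ℝ) : ℂ) • 1) (((u 0 : ℝ) : ℂ) • 1)
        (-C (Fin.tail u)), fun u => ?_, fun u => ?_, fun u v => ?_⟩
    · rw [Matrix.IsHermitian, Matrix.fromBlocks_conjTranspose]
      simp [(hH (Fin.tail u)).eq]
    · have h : u ⬝ᵥ u = u 0 * u 0 + Fin.tail u ⬝ᵥ Fin.tail u := by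
        simp [dotProduct, Fin.sum_univ_succ, Fin.tail]
      rw [Matrix.fromBlocks_multiply, h, ← Matrix.fromBlocks_one, Matrix.fromBlocks_smul]
      congr 1
      · simp [hsq, smul_smul, add_smul, add_comm, -Complex.ofReal_mul]
      · simp
      · simp
      · simp [hsq, smul_smul, add_smul, -Complex.ofReal_mul]
    · rw [Matrix.fromBlocks_add]
      have : Fin.tail (u + v) = Fin.tail u + Fin.tail v := rfl
      simp [this, hadd, add_smul, add_comm]

/-- The trace formula follows from `C u * C u = ‖u‖²` by polarization, which needs only additivity
of `C`. -/
lemma exists_clifford (κ : Type*) [Fintype κ] :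
    ∃ (N : ℕ) (C : (κ → ℝ) → Matrix (Fin N) (Fin N) ℂ), 0 < N ∧ (∀ u, (C u).IsHermitian) ∧
      (∀ u, u ⬝ᵥ u = 1 → C u * C u = 1) ∧
      ∀ u v, (C u * C v).trace = (N : ℂ) * ((u ⬝ᵥ v : ℝ) : ℂ) := by
  obtain ⟨ι, _, _, _, C, hH, hsq, hadd⟩ := exists_clifford_fin (Fintype.card κ)
  let e := Fintype.equivFin κ
  let e' := (Fintype.equivFin ι).symm
  have hdot : ∀ u v : κ → ℝ, (u ∘ e.symm) ⬝ᵥ (v ∘ e.symm) = u ⬝ᵥ v := fun u v => by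
    simp [dotProduct, Equiv.sum_comp e.symm fun k => u k * v k]
  have htr : ∀ u v : κ → ℝ, (C (u ∘ e.symm) * C (v ∘ e.symm)).trace =
      (Fintype.card ι : ℂ) * ((u ⬝ᵥ v : ℝ) : ℂ) := fun u v => by
    have h1 : ∀ w : κ → ℝ, (C (w ∘ e.symm) * C (w ∘ e.symm)).trace =
        (Fintype.card ι : ℂ) * ((w ⬝ᵥ w : ℝ) : ℂ) := fun w => by
      rw [hsq, hdot, Matrix.trace_smul, Matrix.trace_one, smul_eq_mul, mul_comm]
    have h2 := h1 (u + v)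
    have h3 : (u + v) ∘ e.symm = u ∘ e.symm + v ∘ e.symm := rfl
    rw [h3, hadd, add_mul, mul_add, mul_add, Matrix.trace_add, Matrix.trace_add, Matrix.trace_add,
      h1, h1, Matrix.trace_mul_comm (C (v ∘ e.symm))] at h2
    simp only [add_dotProduct, dotProduct_add, dotProduct_comm v u] at h2
    push_cast at h2
    linear_combination h2 / 2
  refine ⟨Fintype.card ι, fun u => (C (u ∘ e.symm)).submatrix e' e', Fintype.card_pos,
    fun u => (hH _).submatrix e', fun u hu => ?_, fun u v => ?_⟩
  · rw [Matrix.submatrix_mul_equiv, hsq, hdot, hu]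
    simp
  · rw [Matrix.submatrix_mul_equiv, ← htr]
    simp only [Matrix.trace, Matrix.diag_apply, Matrix.submatrix_apply]
    exact Equiv.sum_comp e' fun i => (C (u ∘ e.symm) * C (v ∘ e.symm)) i i

/-- The maximally entangled state. -/
def maxEntangled (N : ℕ) : Matrix (Fin N × Fin N) (Fin N × Fin N) ℂ :=
  (N : ℂ)⁻¹ • Matrix.vecMulVec (fun p => if p.1 = p.2 then 1 else 0)
    (star fun p => if p.1 = p.2 then 1 else 0)

lemma maxEntangled_posSemidef (N : ℕ) : (maxEntangled N).PosSemidef :=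
  (Matrix.posSemidef_vecMulVec_self_star _).smul (by positivity)

/-- The transpose here is the reason why Bob later measures transposed Clifford matrices. -/
lemma trace_maxEntangled_mul_kronecker {N : ℕ} (X Y : Matrix (Fin N) (Fin N) ℂ) :
    (maxEntangled N * (X ⊗ₖ Y)).trace = (N : ℂ)⁻¹ * (X * Yᵀ).trace := by
  rw [maxEntangled, Matrix.smul_mul, Matrix.trace_smul, smul_eq_mul]
  congr 1
  simp only [Matrix.trace, Matrix.diag_apply, Matrix.mul_apply, Fintype.sum_prod_type,
    Matrix.vecMulVec_apply, Pi.star_apply, Matrix.kroneckerMap_apply, Matrix.transpose_apply]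
  simp only [apply_ite star, star_one, star_zero, ite_mul, mul_ite, one_mul, mul_one, mul_zero,
    zero_mul, Finset.sum_ite_eq, Finset.mem_univ, if_true]
  rw [Finset.sum_comm]
  refine (Finset.sum_congr rfl fun y _ => ?_).trans Finset.sum_comm
  rw [Finset.sum_comm]
  simp

lemma trace_maxEntangled {N : ℕ} (hN : 0 < N) : (maxEntangled N).trace = 1 := by
  have h := trace_maxEntangled_mul_kronecker (1 : Matrix (Fin N) (Fin N) ℂ) 1
  have hN' : (N : ℂ) ≠ 0 := by exact_mod_cast hN.ne'
  simpa [hN'] using h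

/-- The sign `(-1) ^ a` of a bit `a`. -/
def bitSign (a : Fin 2) : ℝ := if a = 0 then 1 else -1

@[simp] lemma bitSign_zero : bitSign 0 = 1 := rfl

@[simp] lemma bitSign_one : bitSign 1 = -1 := rfl

lemma bitSign_mul_self (a : Fin 2) : bitSign a * bitSign a = 1 := by
  fin_cases a <;> simp

lemma bitSign_add (a b : Fin 2) : bitSign (a + b) = bitSign a * bitSign b := by
  fin_cases a <;> fin_cases b <;> simp

namespace BellScenario

lemma isProjectiveMeasurement_bit {m N : ℕ} {A : Fin m → Matrix (Fin N) (Fin N) ℂ}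
    (hA : ∀ x, (A x).IsHermitian) (hA' : ∀ x, A x * A x = 1) :
    IsProjectiveMeasurement (d := fun _ => 2) fun k : Σ _ : Fin m, Fin 2 =>
      (2⁻¹ : ℂ) • (1 + ((bitSign k.2 : ℝ) : ℂ) • A k.1) where
  hermitian k := by
    rw [Matrix.IsHermitian, Matrix.conjTranspose_smul, Matrix.conjTranspose_add,
      Matrix.conjTranspose_smul, (hA k.1).eq]
    simp
  orthogonal x a a' := by
    have h : ∀ s t : ℂ, ((2⁻¹ : ℂ) • (1 + s • A x)) * ((2⁻¹ : ℂ) • (1 + t • A x)) =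
        (4⁻¹ * (1 + s * t)) • 1 + (4⁻¹ * (s + t)) • A x := fun s t => by
      simp only [Matrix.smul_mul, Matrix.mul_smul, add_mul, mul_add, hA', one_mul, mul_one]
      module
    simp only [h]
    fin_cases a <;> fin_cases a' <;> simp <;> module
  complete x := by
    change ∑ a : Fin 2, (2⁻¹ : ℂ) • (1 + ((bitSign a : ℝ) : ℂ) • A x) = 1
    simp [Fin.sum_univ_two]
    module

/-- The entry `P(a, b | x, y)` of a box of the scenario with two outputs per input. -/
def bitEntry {mA mB : ℕ} (P : (binary mA mB).Box) (x : Fin mA) (y : Fin mB) (a b : Fin 2) : ℝ :=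
  P (⟨x, a⟩, ⟨y, b⟩)

/-- Inner products of unit vectors are the correlations of a quantum box. -/
lemma exists_mem_quantum_binary {mA mB : ℕ} {κ : Type*} [Fintype κ] (u : Fin mA → κ → ℝ)
    (v : Fin mB → κ → ℝ) (hu : ∀ x, u x ⬝ᵥ u x = 1) (hv : ∀ y, v y ⬝ᵥ v y = 1) :
    ∃ P ∈ (binary mA mB).quantum, ∃ (r : Fin mA → ℝ) (t : Fin mB → ℝ), ∀ x y (a b : Fin 2),
      bitEntry P x y a b = (1 + bitSign a * r x + bitSign b * t y +
        bitSign a * bitSign b * (u x ⬝ᵥ v y)) / 4 := by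
  obtain ⟨N, C, hN, hH, hsq, htr⟩ := exists_clifford κ
  have hN' : (N : ℂ) ≠ 0 := by exact_mod_cast hN.ne'
  have hreal : ∀ w, (((C w).trace.re : ℝ) : ℂ) = (C w).trace := fun w => by
    refine Complex.conj_eq_iff_re.1 ?_
    conv_rhs => rw [← (hH w).eq, Matrix.trace_conjTranspose]
    rfl
  -- The marginals are whatever the traces give; XOR functionals do not see them.
  refine ⟨fun e => (1 + bitSign e.1.2 * ((N : ℝ)⁻¹ * (C (u e.1.1)).trace.re) +
    bitSign e.2.2 * ((N : ℝ)⁻¹ * (C (v e.2.1)).trace.re) +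
    bitSign e.1.2 * bitSign e.2.2 * (u e.1.1 ⬝ᵥ v e.2.1)) / 4,
    ⟨N, N, maxEntangled N, _, _, maxEntangled_posSemidef N, trace_maxEntangled hN,
    isProjectiveMeasurement_bit (A := fun x => C (u x)) (fun x => hH _) (fun x => hsq _ (hu x)),
    isProjectiveMeasurement_bit (A := fun y => (C (v y))ᵀ) (fun y => (hH _).transpose)
      (fun y => by rw [← Matrix.transpose_mul, hsq _ (hv y), Matrix.transpose_one]), ?_⟩,
    fun x => (N : ℝ)⁻¹ * (C (u x)).trace.re, fun y => (N : ℝ)⁻¹ * (C (v y)).trace.re,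
    fun x y a b => rfl⟩
  rintro ⟨x, a⟩ ⟨y, b⟩
  rw [trace_maxEntangled_mul_kronecker, Matrix.transpose_smul, Matrix.transpose_add,
    Matrix.transpose_smul, Matrix.transpose_transpose, Matrix.transpose_one]
  simp only [Matrix.smul_mul, Matrix.mul_smul, add_mul, mul_add, one_mul, mul_one, Matrix.trace_smul, Matrix.trace_add, htr, Matrix.trace_one,
    smul_eq_mul, Fintype.card_fin]
  push_cast
  rw [hreal, hreal]
  field_simp
  ring

end BellScenario

/-! ### XOR games -/

namespace XORGame

variable {mA mB : ℕ} (G : XORGame mA mB)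

open BellScenario

/-- The weights of the correlators in the Bell functional of an XOR game. -/
def weight : Matrix (Fin mA) (Fin mB) ℝ := fun x y => G.q x y * bitSign (G.f x y)

lemma bell_dotProduct (P : (binary mA mB).Box) :
    G.bell ⬝ᵥ P = ∑ x : Fin mA, ∑ y : Fin mB, G.q x y *
      (bitEntry P x y 0 (G.f x y) + bitEntry P x y 1 (1 + G.f x y)) := by
  simp only [dotProduct, Fintype.sum_prod_type, Fintype.sum_sigma]
  refine Finset.sum_congr rfl fun x _ => ?_
  rw [Finset.sum_comm]
  refine Finset.sum_congr rfl fun y _ => ?_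
  change ∑ a : Fin 2, ∑ b : Fin 2, (if a + b = G.f x y then G.q x y else 0) *
    bitEntry P x y a b = _
  generalize G.f x y = c
  fin_cases c <;> simp [Fin.sum_univ_two, mul_add]

/-- The two winning answer pairs are bitwise complements, so the marginal terms cancel. -/
lemma bell_dotProduct_of_correlations {P : (binary mA mB).Box} {r : Fin mA → ℝ} {t : Fin mB → ℝ}
    {E : Fin mA → Fin mB → ℝ} (hP : ∀ x y a b, bitEntry P x y a b =
      (1 + bitSign a * r x + bitSign b * t y + bitSign a * bitSign b * E x y) / 4) :
    G.bell ⬝ᵥ P = (1 + ∑ x, ∑ y, G.weight x y * E x y) / 2 := by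
  rw [bell_dotProduct, ← G.q_sum, ← Finset.sum_add_distrib, Finset.sum_div]
  refine Finset.sum_congr rfl fun x _ => ?_
  rw [← Finset.sum_add_distrib, Finset.sum_div]
  refine Finset.sum_congr rfl fun y _ => ?_
  rw [hP, hP, bitSign_add, weight, bitSign_zero, bitSign_one]
  ring

/-- The deterministic box of a pair of strategies for two outputs per input. -/
def bitDetBox (f : Fin mA → Fin 2) (h : Fin mB → Fin 2) : (binary mA mB).Box :=
  (binary mA mB).detBox (f, h)

lemma bell_dotProduct_bitDetBox (f : Fin mA → Fin 2) (h : Fin mB → Fin 2) :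
    G.bell ⬝ᵥ bitDetBox f h =
      (1 + ∑ x, ∑ y, G.weight x y * (bitSign (f x) * bitSign (h y))) / 2 := by
  refine G.bell_dotProduct_of_correlations (r := fun x => bitSign (f x))
    (t := fun y => bitSign (h y)) (E := fun x y => bitSign (f x) * bitSign (h y)) fun x y a b => ?_
  have hr : ∀ a b : Fin 2, (if a = b then (1 : ℝ) else 0) = (1 + bitSign b * bitSign a) / 2 := by
    intro a b
    fin_cases a <;> fin_cases b <;> simp
  change (if f x = a then (1 : ℝ) else 0) * (if h y = b then (1 : ℝ) else 0) = _
  rw [hr, hr]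
  ring

/-- A bound on the quantum value bounds the correlations given by all Gram matrices. -/
lemma sum_weight_mul_le {ω : ℝ} (hω : ∀ P ∈ (binary mA mB).quantum, G.bell ⬝ᵥ P ≤ ω)
    {X : Matrix (Fin mA ⊕ Fin mB) (Fin mA ⊕ Fin mB) ℝ} (hX : X.PosSemidef) {t : ℝ}
    (ht : ∀ i, X i i = t) :
    ∑ x, ∑ y, G.weight x y * X (.inl x) (.inr y) ≤ (2 * ω - 1) * t := by
  classical
  obtain ⟨B, rfl⟩ : ∃ B : Matrix (Fin mA ⊕ Fin mB) (Fin mA ⊕ Fin mB) ℝ, X = Bᵀ * B :=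
    Matrix.PosSemidef.exists_eq_transpose_mul hX
  set c : Fin mA ⊕ Fin mB → Fin mA ⊕ Fin mB → ℝ := fun i k => B k i with hc
  have hB : ∀ i j, (Bᵀ * B) i j = c i ⬝ᵥ c j := fun i j => by
    simp [Matrix.mul_apply, dotProduct, hc]
  simp only [hB] at ht ⊢
  by_cases ht0 : t = 0
  · have : ∀ i, c i = 0 := fun i => dotProduct_self_eq_zero.1 ((ht i).trans ht0)
    simp [this, ht0]
  have hi : Nonempty (Fin mA ⊕ Fin mB) := by
    by_contra hne
    rw [not_nonempty_iff, isEmpty_sum] at hne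
    have := hne.1
    simpa using G.q_sum
  have htpos : 0 < t := by
    obtain ⟨i⟩ := hi
    refine lt_of_le_of_ne ?_ (Ne.symm ht0)
    rw [← ht i]
    exact Finset.sum_nonneg fun k _ => mul_self_nonneg _
  have hs : (√t)⁻¹ * (√t)⁻¹ = t⁻¹ := by
    rw [← mul_inv, Real.mul_self_sqrt htpos.le]
  have hunit : ∀ i j, ((√t)⁻¹ • c i) ⬝ᵥ ((√t)⁻¹ • c j) = t⁻¹ * (c i ⬝ᵥ c j) := fun i j => by
    rw [smul_dotProduct, dotProduct_smul, smul_eq_mul, smul_eq_mul, ← mul_assoc, hs]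
  -- Tsirelson: the Gram vectors, rescaled to unit length, are realized as quantum correlations.
  obtain ⟨P, hPQ, r, s, hP⟩ := exists_mem_quantum_binary
    (fun x : Fin mA => (√t)⁻¹ • c (.inl x)) (fun y : Fin mB => (√t)⁻¹ • c (.inr y))
    (fun x => by rw [hunit, ht, inv_mul_cancel₀ ht0]) fun y => by rw [hunit, ht, inv_mul_cancel₀ ht0]
  have h := hω P hPQ
  rw [G.bell_dotProduct_of_correlations hP] at h
  have h2 : ∑ x, ∑ y, G.weight x y * (c (.inl x) ⬝ᵥ c (.inr y)) =
      t * ∑ x, ∑ y, G.weight x y * (((√t)⁻¹ • c (.inl x)) ⬝ᵥ ((√t)⁻¹ • c (.inr y))) := by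
    simp only [Finset.mul_sum]
    refine Finset.sum_congr rfl fun x _ => Finset.sum_congr rfl fun y _ => ?_
    rw [hunit]
    field_simp
  rw [h2, mul_comm]
  exact mul_le_mul_of_nonneg_right (by linarith) htpos.le

/-- The symmetric matrices with constant diagonal. -/
def constDiag (I : Type*) : Submodule ℝ (Matrix I I ℝ) where
  carrier := {c | cᵀ = c ∧ ∀ i j, c i i = c j j}
  add_mem' := fun ⟨hc, hc'⟩ ⟨hd, hd'⟩ => ⟨by rw [Matrix.transpose_add, hc, hd], fun i j => by
    rw [Matrix.add_apply, Matrix.add_apply, hc' i j, hd' i j]⟩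
  zero_mem' := ⟨Matrix.transpose_zero, fun _ _ => rfl⟩
  smul_mem' r c := fun ⟨hc, hc'⟩ => ⟨by rw [Matrix.transpose_smul, hc], fun i j => by
    rw [Matrix.smul_apply, Matrix.smul_apply, hc' i j]⟩

/-- Duality: if the quantum value of an XOR game is at most `ω`, then the strategies of value `ω`
satisfy linear equations that involve only marginals. -/
lemma exists_marginal_equations {ω : ℝ} (hω : ∀ P ∈ (binary mA mB).quantum, G.bell ⬝ᵥ P ≤ ω) :
    ∃ l : Fin mA → ℝ, ∀ (f : Fin mA → Fin 2) (h : Fin mB → Fin 2),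
      G.bell ⬝ᵥ bitDetBox f h = ω →
      ∀ x, l x * bitSign (f x) - ∑ y, G.weight x y / 2 * bitSign (h y) = 0 := by
  classical
  by_cases hI : IsEmpty (Fin mA)
  · exact ⟨fun _ => 0, fun f h _ x => (hI.false x).elim⟩
  rw [not_isEmpty_iff] at hI
  obtain ⟨x₀⟩ := hI
  let i₀ : Fin mA ⊕ Fin mB := .inl x₀
  -- On constant-diagonal matrices the entry at `i₀` stands for the common diagonal value. The
  -- factor `2 * ω - 1` converts a winning probability into a correlation.
  let φ : Matrix (Fin mA ⊕ Fin mB) (Fin mA ⊕ Fin mB) ℝ :=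
    (2 * ω - 1) • Matrix.single i₀ i₀ 1 - Matrix.fromBlocks 0 G.weight 0 0
  have hφ : ∀ c, matrixPairing φ c =
      (2 * ω - 1) * c i₀ i₀ - ∑ x, ∑ y, G.weight x y * c (.inl x) (.inr y) := fun c => by
    simp only [matrixPairing_apply, φ, Matrix.sub_apply, mul_sub, Finset.sum_sub_distrib]
    congr 1
    · simp [Matrix.single_apply, ite_and, mul_comm]
    · simp [Fintype.sum_sum_type, mul_comm]
  obtain ⟨β, hβ, hβp, hβ0⟩ := exists_matrixPairing_extension Set.univ
    (constDiag (Fin mA ⊕ Fin mB)) (fun c hc => hc.1)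
    ⟨Matrix.transpose_one, fun i j => by simp⟩ φ fun c hc hc0 => by
      have hps : c.PosSemidef := by
        refine .of_dotProduct_mulVec_nonneg (by simpa [Matrix.IsHermitian] using hc.1) fun u => ?_
        have := hc0 u (Set.mem_univ _)
        rw [star_trivial]
        refine this.trans_eq ?_
        simp only [matrixPairing_apply, Matrix.vecMulVec_apply, dotProduct, Matrix.mulVec,
          Finset.mul_sum]
        exact Finset.sum_congr rfl fun i _ => Finset.sum_congr rfl fun j _ => by ring
      rw [hφ]
      linarith [G.sum_weight_mul_le hω hps fun i => hc.2 i i₀]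
  -- Symmetric off-diagonal units have zero diagonal, so they lie in the subspace and fix `β` off
  -- the diagonal. The individual diagonal entries remain free and supply the unknown `l`.
  have hoff : ∀ i j, i ≠ j → 2 * β i j = φ i j + φ j i := fun i j hij => by
    have hsingle : ∀ ψ : Matrix (Fin mA ⊕ Fin mB) (Fin mA ⊕ Fin mB) ℝ,
        matrixPairing ψ (Matrix.single i j 1 + Matrix.single j i 1) = ψ i j + ψ j i := fun ψ => by
      rw [map_add]
      simp [matrixPairing_apply, Matrix.single_apply, ite_and]
    have h := hβp (Matrix.single i j 1 + Matrix.single j i 1)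
      ⟨by simp [add_comm], fun k k' => by
        simp only [Matrix.add_apply, Matrix.single_apply]
        grind⟩
    rw [hsingle, hsingle] at h
    have := congrFun (congrFun hβ i) j
    rw [Matrix.transpose_apply] at this
    linarith
  refine ⟨fun x => β (.inl x) (.inl x), fun f h hfh x => ?_⟩
  let s : Fin mA ⊕ Fin mB → ℝ := Sum.elim (fun x => bitSign (f x)) (fun y => bitSign (h y))
  have hs : ∀ i, s i * s i = 1 := by
    rintro (x | y) <;> exact bitSign_mul_self _
  -- For an optimal sign vector, `s sᵀ` has constant diagonal 1, and its value under `φ` is twice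
  -- the slack, hence zero.
  have hzero : β *ᵥ s = 0 := by
    refine mulVec_eq_zero_of_nonnegOnCone hβ hβ0 ?_
    rw [← matrixPairing_vecMulVec, hβp _ ⟨Matrix.transpose_vecMulVec _ _, fun i j => by
      simp only [Matrix.vecMulVec_apply, hs]⟩, hφ]
    simp only [Matrix.vecMulVec_apply, hs]
    rw [bell_dotProduct_bitDetBox] at hfh
    simp only [s, Sum.elim_inl, Sum.elim_inr]
    linarith
  have hx := congrFun hzero (.inl x)
  rw [Matrix.mulVec, dotProduct, Fintype.sum_sum_type, Finset.sum_eq_single x] at hx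
  · simp only [s, Sum.elim_inl, Sum.elim_inr, Pi.zero_apply] at hx
    rw [← hx, sub_eq_add_neg, ← Finset.sum_neg_distrib]
    congr 1
    refine Finset.sum_congr rfl fun y _ => ?_
    have := hoff (.inl x) (.inr y) (by simp)
    simp only [φ, i₀, Matrix.sub_apply, Matrix.smul_apply, Matrix.single_apply,
      Matrix.fromBlocks_apply₁₂, Matrix.fromBlocks_apply₂₁] at this
    simp only [reduceCtorEq, and_false, false_and, if_false, smul_zero, Matrix.zero_apply] at this
    rw [show β (.inl x) (.inr y) = -(G.weight x y / 2) by linarith]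
    ring
  · intro x' _ hne
    have := hoff (.inl x) (.inl x') (by simpa using Ne.symm hne)
    have h1 : ¬(x₀ = x ∧ x₀ = x') := fun ⟨h, h'⟩ => hne (h'.symm.trans h)
    have h2 : ¬(x₀ = x' ∧ x₀ = x) := fun ⟨h, h'⟩ => hne (h.symm.trans h')
    simp only [φ, i₀, Matrix.sub_apply, Matrix.smul_apply, Matrix.single_apply,
      Matrix.fromBlocks_apply₁₁, Sum.inl.injEq, h1, h2, if_false, smul_zero,
      Matrix.zero_apply] at this
    rw [show β (.inl x) (.inl x') = 0 by linarith, zero_mul]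
  · simp

/-- An XOR game whose functional supports a facet of the classical polytope is won by quantum
players with a larger probability than by classical ones. -/
lemma exists_quantum_advantage {ω : ℝ} (hF : IsFacet (binary mA mB).classical G.bell ω) :
    ∃ P ∈ (binary mA mB).quantum, ω < G.bell ⬝ᵥ P := by
  by_contra! hω
  obtain ⟨hA, hB⟩ := mA_pos_mB_pos_of_isFacet hF
  change 0 < mB at hB
  have hB' : (mB : ℝ) ≠ 0 := by exact_mod_cast hB.ne'
  obtain ⟨l, hl⟩ := G.exists_marginal_equations hω
  rw [classical, localDeterministic_eq_range hA hB] at hF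
  have hall : ∀ (f : Fin mA → Fin 2) (h : Fin mB → Fin 2) (x : Fin mA),
      l x * bitSign (f x) - ∑ y, G.weight x y / 2 * bitSign (h y) = 0 := fun f h x => by
    -- The marginal equation written as a functional of boxes; Alice's term is spread evenly over
    -- Bob's `mB` inputs.
    let v' : Fin mA → Fin mB → Fin 2 → Fin 2 → ℝ := fun x' y a b => if x' = x then
      l x * bitSign a / mB - G.weight x y / 2 * bitSign b else 0
    let v : (binary mA mB).Box := fun e => v' e.1.1 e.2.1 e.1.2 e.2.2
    have hv : ∀ (f : Fin mA → Fin 2) (h : Fin mB → Fin 2), v ⬝ᵥ bitDetBox f h =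
        l x * bitSign (f x) - ∑ y, G.weight x y / 2 * bitSign (h y) := fun f h => by
      refine (dotProduct_detBox v (f, h)).trans ?_
      change ∑ x' : Fin mA, ∑ y : Fin mB, (if x' = x then
        l x * bitSign (f x') / mB - G.weight x y / 2 * bitSign (h y) else 0) = _
      rw [Finset.sum_eq_single x (fun x' _ hne => by simp [hne]) (by simp)]
      simp only [if_true, Finset.sum_sub_distrib, Finset.sum_const, Finset.card_univ,
        Fintype.card_fin, nsmul_eq_mul]
      rw [mul_div_cancel₀ _ hB']
    obtain ⟨c, hc⟩ := hF.exists_mul_eq (v := v) (k := 0) (by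
      rintro _ ⟨⟨f, h⟩, rfl⟩ hfh
      rw [zero_add]
      exact (hv f h).trans (hl f h hfh x))
    have h1 := hc (bitDetBox f h) ⟨(f, h), rfl⟩
    -- Flipping all answers negates the left side and preserves the slack, so both sides vanish.
    have h2 := hc (bitDetBox (fun x => f x + 1) fun y => h y + 1) ⟨_, rfl⟩
    rw [zero_add, hv, bell_dotProduct_bitDetBox] at h1 h2
    simp only [bitSign_add, bitSign_one, mul_neg, mul_one, neg_mul, neg_neg,
      Finset.sum_neg_distrib] at h2
    linarith
  have hq : ∀ x y, G.q x y = 0 := fun x y => by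
    have h1 := hall 0 0 x
    -- Flipping Bob's bit at `y` alone isolates the weight of `(x, y)`.
    have h2 := hall 0 (Pi.single y 1) x
    have h3 : ∑ y', G.weight x y' / 2 * bitSign ((0 : Fin mB → Fin 2) y') -
        ∑ y', G.weight x y' / 2 * bitSign ((Pi.single y 1 : Fin mB → Fin 2) y') =
        G.weight x y := by
      rw [← Finset.sum_sub_distrib, Finset.sum_eq_single y]
      · simp
      · intro y' _ hne
        simp [hne]
      · simp
    have h4 : G.weight x y = 0 := by rw [← h3]; linarith
    rw [weight] at h4
    refine (mul_eq_zero.1 h4).resolve_right fun h5 => ?_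
    have := bitSign_mul_self (G.f x y)
    rw [h5] at this
    simp at this
  have := G.q_sum
  simp [hq] at this

end XORGame

/-! ### Wirings -/

section Wiring

variable {X Y : Type*} [Fintype X] [Fintype Y]
  {α : X → Type*} {β : Y → Type*}

/-- A function of the form `(f, h) ↦ ∑ x y, L x y (f x) (h y)` is a projection-like functional if
products of its variations in different inputs vanish: of second variations, of variations in
Alice's inputs, and of variations in Bob's inputs. -/
structure IsProjectionLike (L : ∀ x y, α x → β y → ℝ) : Prop where
  mixed : ∀ x x' y y', x ≠ x' → y ≠ y' → ∀ a₁ a₂ b₁ b₂ a₁' a₂' b₁' b₂',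
    (L x y a₁ b₁ - L x y a₂ b₁ - (L x y a₁ b₂ - L x y a₂ b₂)) *
      (L x' y' a₁' b₁' - L x' y' a₂' b₁' - (L x' y' a₁' b₂' - L x' y' a₂' b₂')) = 0
  left : ∀ (h : ∀ y, β y) x x', x ≠ x' → ∀ a₁ a₂ a₁' a₂',
    (∑ y, L x y a₁ (h y) - ∑ y, L x y a₂ (h y)) *
      (∑ y, L x' y a₁' (h y) - ∑ y, L x' y a₂' (h y)) = 0
  right : ∀ (f : ∀ x, α x) y y', y ≠ y' → ∀ b₁ b₂ b₁' b₂',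
    (∑ x, L x y (f x) b₁ - ∑ x, L x y (f x) b₂) *
      (∑ x, L x y' (f x) b₁' - ∑ x, L x y' (f x) b₂') = 0

variable {L : ∀ x y, α x → β y → ℝ}

lemma IsProjectionLike.swap (hL : IsProjectionLike L) :
    IsProjectionLike fun y x b a => L x y a b where
  mixed y y' x x' hy hx b₁ b₂ a₁ a₂ b₁' b₂' a₁' a₂' := by
    rw [← hL.mixed x x' y y' hx hy a₁ a₂ b₁ b₂ a₁' a₂' b₁' b₂']
    ring
  left := hL.right
  right := hL.left

variable [DecidableEq X] [DecidableEq Y]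

/-- A projection-like function depends on the answer of one party to only one input. -/
lemma IsProjectionLike.exists_pivot [Nonempty X] (hL : IsProjectionLike L) (f₀ : ∀ x, α x) :
    (∃ x₀, ∀ x, x ≠ x₀ → ∀ (h : ∀ y, β y) a₁ a₂, ∑ y, L x y a₁ (h y) = ∑ y, L x y a₂ (h y)) ∨
    (∃ y₀, ∀ y, y ≠ y₀ → ∀ (f : ∀ x, α x) b₁ b₂, ∑ x, L x y (f x) b₁ = ∑ x, L x y (f x) b₂) := by
  by_cases H : ∃ (x x' : X) (h h' : ∀ y, β y) (a₁ a₂ : α x) (a₁' a₂' : α x'), x ≠ x' ∧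
      ∑ y, L x y a₁ (h y) ≠ ∑ y, L x y a₂ (h y) ∧ ∑ y, L x' y a₁' (h' y) ≠ ∑ y, L x' y a₂' (h' y)
  · right
    obtain ⟨x, x', h, h', a₁, a₂, a₁', a₂', hx, hne, hne'⟩ := H
    -- Two of Alice's inputs matter, but never against the same strategy of Bob. Their effects
    -- therefore change between `h` and `h'`, which gives nonzero second variations.
    have e1 : ∑ y, L x' y a₁' (h y) - ∑ y, L x' y a₂' (h y) = 0 :=
      (mul_eq_zero.1 (hL.left h x x' hx a₁ a₂ a₁' a₂')).resolve_left (sub_ne_zero.2 hne)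
    have e2 : ∑ y, L x y a₁ (h' y) - ∑ y, L x y a₂ (h' y) = 0 :=
      (mul_eq_zero.1 (hL.left h' x x' hx a₁ a₂ a₁' a₂')).resolve_right (sub_ne_zero.2 hne')
    obtain ⟨y₀, -, hy₀⟩ : ∃ y ∈ Finset.univ, L x y a₁ (h y) - L x y a₂ (h y) -
        (L x y a₁ (h' y) - L x y a₂ (h' y)) ≠ 0 := by
      refine Finset.exists_ne_zero_of_sum_ne_zero ?_
      simp only [Finset.sum_sub_distrib]
      rw [e2, sub_zero]
      exact sub_ne_zero.2 hne
    obtain ⟨y₁, -, hy₁⟩ : ∃ y ∈ Finset.univ, L x' y a₁' (h y) - L x' y a₂' (h y) -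
        (L x' y a₁' (h' y) - L x' y a₂' (h' y)) ≠ 0 := by
      refine Finset.exists_ne_zero_of_sum_ne_zero ?_
      simp only [Finset.sum_sub_distrib]
      rw [e1, zero_sub]
      exact neg_ne_zero.2 (sub_ne_zero.2 hne')
    -- `mixed` forces both second variations to sit at one input of Bob, the pivot.
    obtain rfl : y₀ = y₁ := by
      by_contra hy
      exact mul_ne_zero hy₀ hy₁ (hL.mixed x x' y₀ y₁ hx hy _ _ _ _ _ _ _ _)
    refine ⟨y₀, fun y hy f b₁ b₂ => ?_⟩
    -- Any `x''` differs from `x` or from `x'`, so one of the two nonzero second variations at `y₀`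
    -- kills it.
    have hzero : ∀ x'' c₁ c₂, L x'' y c₁ b₁ - L x'' y c₂ b₁ -
        (L x'' y c₁ b₂ - L x'' y c₂ b₂) = 0 := fun x'' c₁ c₂ => by
      by_cases hx'' : x'' = x
      · exact (mul_eq_zero.1 (hL.mixed x'' x' y y₀ (hx'' ▸ hx) hy c₁ c₂ b₁ b₂ _ _ _ _)).resolve_right
          hy₁
      · exact (mul_eq_zero.1 (hL.mixed x'' x y y₀ hx'' hy c₁ c₂ b₁ b₂ _ _ _ _)).resolve_right hy₀
    have hindep : ∀ f' : ∀ x, α x, ∑ x, L x y (f x) b₁ - ∑ x, L x y (f x) b₂ =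
        ∑ x, L x y (f' x) b₁ - ∑ x, L x y (f' x) b₂ := fun f' => by
      rw [← Finset.sum_sub_distrib, ← Finset.sum_sub_distrib]
      exact Finset.sum_congr rfl fun x'' _ => by linarith [hzero x'' (f x'') (f' x'')]
    have hvar : ∀ b, ∑ z, L z y₀ (Function.update f₀ x a₁ z) b -
        ∑ z, L z y₀ (Function.update f₀ x a₂ z) b = L x y₀ a₁ b - L x y₀ a₂ b := fun b => by
      rw [← Finset.sum_sub_distrib, Finset.sum_eq_single x]
      · simp
      · intro z _ hz
        simp [Function.update_of_ne hz]
      · simp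
    -- The effect at `y` does not depend on Alice. Subtracting these two equations multiplies it by
    -- the nonzero second variation at `y₀`, so it vanishes.
    have r1 := hL.right (Function.update f₀ x a₁) y y₀ hy b₁ b₂ (h y₀) (h' y₀)
    have r2 := hL.right (Function.update f₀ x a₂) y y₀ hy b₁ b₂ (h y₀) (h' y₀)
    rw [← hindep] at r1 r2
    have hv := hvar (h y₀)
    have hv' := hvar (h' y₀)
    refine sub_eq_zero.1 ((mul_eq_zero.1 ?_).resolve_right hy₀)
    rw [← hv, ← hv']
    linear_combination r1 - r2
  · left
    push Not at H
    by_cases H' : ∃ (x : X) (h : ∀ y, β y) (a₁ a₂ : α x),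
        ∑ y, L x y a₁ (h y) ≠ ∑ y, L x y a₂ (h y)
    · obtain ⟨x, h, a₁, a₂, hne⟩ := H'
      exact ⟨x, fun x' hx' h' a₁' a₂' => H x x' h h' a₁ a₂ a₁' a₂' hx'.symm hne⟩
    · push Not at H'
      exact ⟨Classical.arbitrary X, fun x _ h a₁ a₂ => H' x h a₁ a₂⟩

/-- A projection-like function that depends on Alice's answer to only one input `x₀` depends on a
single answer of Bob, to an input chosen according to Alice's answer to `x₀`. -/
lemma IsProjectionLike.exists_wiring [Nonempty Y] (hL : IsProjectionLike L) (f₀ : ∀ x, α x)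
    (h₀ : ∀ y, β y) (h01 : ∀ (f : ∀ x, α x) (h : ∀ y, β y), 0 ≤ ∑ x, ∑ y, L x y (f x) (h y)) {x₀ : X}
    (hx₀ : ∀ x, x ≠ x₀ → ∀ (h : ∀ y, β y) a₁ a₂, ∑ y, L x y a₁ (h y) = ∑ y, L x y a₂ (h y)) :
    ∃ (y : α x₀ → Y) (c : ∀ a, β (y a) → ℝ), (∀ a b, 0 ≤ c a b) ∧
      ∀ (f : ∀ x, α x) (h : ∀ y, β y),
        ∑ x, ∑ y, L x y (f x) (h y) = c (f x₀) (h (y (f x₀))) := by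
  -- Once Alice's strategy is fixed, `right` lets at most one input of Bob matter.
  have hex : ∀ a, ∃ y₀, ∀ y, y ≠ y₀ → ∀ b₁ b₂, ∑ x, L x y (Function.update f₀ x₀ a x) b₁ =
      ∑ x, L x y (Function.update f₀ x₀ a x) b₂ := fun a => by
    by_cases H : ∃ y₀ b₁ b₂, ∑ x, L x y₀ (Function.update f₀ x₀ a x) b₁ ≠
      ∑ x, L x y₀ (Function.update f₀ x₀ a x) b₂
    · obtain ⟨y₀, b₁, b₂, hne⟩ := H
      exact ⟨y₀, fun y hy b₁' b₂' => sub_eq_zero.1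
        ((mul_eq_zero.1 (hL.right _ y y₀ hy b₁' b₂' b₁ b₂)).resolve_right (sub_ne_zero.2 hne))⟩
    · push Not at H
      exact ⟨Classical.arbitrary Y, fun y _ => H y⟩
  choose y hy using hex
  refine ⟨y, fun a b => ∑ x, ∑ y', L x y' (Function.update f₀ x₀ a x)
    (Function.update h₀ (y a) b y'), fun a b => h01 _ _, fun f h => ?_⟩
  calc ∑ x, ∑ y, L x y (f x) (h y)
      = ∑ x, ∑ y, L x y (Function.update f₀ x₀ (f x₀) x) (h y) := by
        refine Finset.sum_congr rfl fun x _ => ?_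
        by_cases hx : x = x₀
        · subst hx; simp
        · exact hx₀ x hx h _ _
    _ = ∑ y', ∑ x, L x y' (Function.update f₀ x₀ (f x₀) x) (h y') := Finset.sum_comm
    _ = ∑ y', ∑ x, L x y' (Function.update f₀ x₀ (f x₀) x)
          (Function.update h₀ (y (f x₀)) (h (y (f x₀))) y') := by
        refine Finset.sum_congr rfl fun y' _ => ?_
        by_cases hy' : y' = y (f x₀)
        · subst hy'; simp
        · exact hy _ y' hy' _ _
    _ = _ := Finset.sum_comm

end Wiring

namespace BellScenario

variable {S : BellScenario}

/-- A nonnegative projection-like functional is nonnegative at affine combinations of local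
deterministic boxes with nonnegative entries. -/
lemma sum_mul_nonneg_of_isProjectionLike (hA : 0 < S.mA) (hB : 0 < S.mB)
    {L : ∀ x y, Fin (S.dA x) → Fin (S.dB y) → ℝ} (hL : IsProjectionLike L)
    (h0 : ∀ s : S.Strategy, 0 ≤ ∑ x, ∑ y, L x y (s.1 x) (s.2 y)) (s₀ : S.Strategy)
    {w : S.Strategy → ℝ} (hw : ∀ e, 0 ≤ (∑ s, w s • S.detBox s) e) :
    0 ≤ ∑ s : S.Strategy, w s * ∑ x, ∑ y, L x y (s.1 x) (s.2 y) := by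
  have : Nonempty (Fin S.mA) := ⟨⟨0, hA⟩⟩
  have : Nonempty (Fin S.mB) := ⟨⟨0, hB⟩⟩
  rcases hL.exists_pivot s₀.1 with ⟨x₀, hx₀⟩ | ⟨y₀, hy₀⟩
  · obtain ⟨y, c, hc, h⟩ := hL.exists_wiring s₀.1 s₀.2 (fun f h => h0 (f, h)) hx₀
    -- A wiring is linear in the box with nonnegative coefficients, so nonnegative entries suffice
    -- even for signed `w`.
    have : ∑ s : S.Strategy, w s * ∑ x, ∑ y, L x y (s.1 x) (s.2 y) =
        ∑ a, ∑ b, c a b * (∑ s, w s • S.detBox s) (⟨x₀, a⟩, ⟨y a, b⟩) := by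
      have e : ∀ s : S.Strategy, w s * ∑ x, ∑ y, L x y (s.1 x) (s.2 y) =
          ∑ a, ∑ b, c a b * (w s * S.detBox s (⟨x₀, a⟩, ⟨y a, b⟩)) := fun s => by
        rw [h, ← sum_response_mul s.1 x₀ fun a => c a (s.2 (y a)), Finset.mul_sum]
        refine Finset.sum_congr rfl fun a _ => ?_
        rw [← sum_response_mul s.2 (y a) (c a), Finset.mul_sum, Finset.mul_sum]
        exact Finset.sum_congr rfl fun b _ => by rw [detBox]; ring
      simp only [e, Finset.sum_apply, Pi.smul_apply, smul_eq_mul, Finset.mul_sum]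
      rw [Finset.sum_comm]
      exact Finset.sum_congr rfl fun a _ => Finset.sum_comm
    rw [this]
    exact Finset.sum_nonneg fun a _ => Finset.sum_nonneg fun b _ => mul_nonneg (hc a b) (hw _)
  · obtain ⟨x, c, hc, h⟩ := hL.swap.exists_wiring s₀.2 s₀.1 (fun h f => by
      rw [Finset.sum_comm]; exact h0 (f, h)) hy₀
    have : ∑ s : S.Strategy, w s * ∑ x, ∑ y, L x y (s.1 x) (s.2 y) =
        ∑ b, ∑ a, c b a * (∑ s, w s • S.detBox s) (⟨x b, a⟩, ⟨y₀, b⟩) := by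
      have e : ∀ s : S.Strategy, w s * ∑ x, ∑ y, L x y (s.1 x) (s.2 y) =
          ∑ b, ∑ a, c b a * (w s * S.detBox s (⟨x b, a⟩, ⟨y₀, b⟩)) := fun s => by
        rw [Finset.sum_comm, h, ← sum_response_mul s.2 y₀ fun b => c b (s.1 (x b)),
          Finset.mul_sum]
        refine Finset.sum_congr rfl fun b _ => ?_
        rw [← sum_response_mul s.1 (x b) (c b), Finset.mul_sum, Finset.mul_sum]
        exact Finset.sum_congr rfl fun a _ => by rw [detBox]; ring
      simp only [e, Finset.sum_apply, Pi.smul_apply, smul_eq_mul, Finset.mul_sum]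
      rw [Finset.sum_comm]
      exact Finset.sum_congr rfl fun b _ => Finset.sum_comm
    rw [this]
    exact Finset.sum_nonneg fun b _ => Finset.sum_nonneg fun a _ => mul_nonneg (hc b a) (hw _)

end BellScenario

/-! ### Reduced words and moment matrices over deterministic strategies. -/

namespace BellScenario

variable {S : BellScenario}

lemma localProd_some_some_eq_none {m : ℕ} {d : Fin m → ℕ} {k l : Σ x : Fin m, Fin (d x)} :
    localProd (some k) (some l) = none ↔ k ≠ l ∧ k.1 = l.1 := by
  rw [localProd]
  split_ifs with h h' <;> simp [*]

lemma localProd_none_left {m : ℕ} {d : Fin m → ℕ} (k : Option (Σ x : Fin m, Fin (d x))) :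
    localProd none k = some k.toList := by
  cases k <;> rfl

lemma localProd_none_right {m : ℕ} {d : Fin m → ℕ} (k : Option (Σ x : Fin m, Fin (d x))) :
    localProd k none = some k.toList := by
  cases k <;> rfl

lemma response_mul_response_eq_zero {m : ℕ} {d : Fin m → ℕ} (f : ∀ x, Fin (d x))
    {k l : Σ x : Fin m, Fin (d x)} (h : k ≠ l ∧ k.1 = l.1) : response f k * response f l = 0 := by
  obtain ⟨x, a⟩ := k
  obtain ⟨x', a'⟩ := l
  obtain ⟨hne, rfl : x = x'⟩ := h
  by_cases ha : f x = a
  · have : f x ≠ a' := fun ha' => hne (by rw [← ha, ← ha'])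
    simp [response, this]
  · simp [response, ha]

/-! ### Certificates from combinations of deterministic boxes -/

lemma isNoSignalling_sum_smul_detBox {w : S.Strategy → ℝ} (hw : ∑ s, w s = 1)
    (h0 : ∀ e, 0 ≤ (∑ s, w s • S.detBox s) e) : S.IsNoSignalling (∑ s, w s • S.detBox s) where
  nonneg := h0
  normalized x y := by
    simp only [Finset.sum_apply, Pi.smul_apply, smul_eq_mul]
    rw [Finset.sum_congr rfl fun a _ => Finset.sum_comm, Finset.sum_comm, ← hw]
    refine Finset.sum_congr rfl fun s _ => ?_
    simp only [← Finset.mul_sum]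
    rw [(detBox_isNoSignalling s).normalized, mul_one]
  noSignallingAtoB x x' y b := by
    simp only [Finset.sum_apply, Pi.smul_apply, smul_eq_mul]
    rw [Finset.sum_comm, Finset.sum_comm (s := (Finset.univ : Finset (Fin (S.dA x'))))]
    refine Finset.sum_congr rfl fun s _ => ?_
    rw [← Finset.mul_sum, ← Finset.mul_sum, (detBox_isNoSignalling s).noSignallingAtoB x x']
  noSignallingBtoA y y' x a := by
    simp only [Finset.sum_apply, Pi.smul_apply, smul_eq_mul]
    rw [Finset.sum_comm, Finset.sum_comm (s := (Finset.univ : Finset (Fin (S.dB y'))))]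
    refine Finset.sum_congr rfl fun s _ => ?_
    rw [← Finset.mul_sum, ← Finset.mul_sum, (detBox_isNoSignalling s).noSignallingBtoA y y']

/-- The values of the formal operators `{1} ∪ {E_k F_l}` at the deterministic strategies. -/
def evalMatrix (S : BellScenario) : Matrix S.Strategy (Option S.Event) ℝ :=
  fun s Q => Q.elim 1 (S.detBox s)

@[simp] lemma evalMatrix_none (s : S.Strategy) : S.evalMatrix s none = 1 := rfl

@[simp] lemma evalMatrix_some (s : S.Strategy) (e : S.Event) :
    S.evalMatrix s (some e) = S.detBox s e := rfl

/-- The moment matrix of a combination of pairs of deterministic strategies. -/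
def momentMatrix (c : Matrix S.Strategy S.Strategy ℝ) :
    Matrix (Option S.Event) (Option S.Event) ℝ :=
  S.evalMatrixᵀ * c * S.evalMatrix

lemma momentMatrix_apply (c : Matrix S.Strategy S.Strategy ℝ) (Q R : Option S.Event) :
    momentMatrix c Q R = ∑ s', (∑ s, S.evalMatrix s Q * c s s') * S.evalMatrix s' R := by
  simp [momentMatrix, Matrix.mul_apply]

lemma momentMatrix_vecMulVec (u w : S.Strategy → ℝ) :
    momentMatrix (Matrix.vecMulVec u w) =
      Matrix.vecMulVec (u ᵥ* S.evalMatrix) (w ᵥ* S.evalMatrix) := by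
  rw [momentMatrix, Matrix.mul_vecMulVec, Matrix.vecMulVec_mul, Matrix.mulVec_transpose]

lemma momentMatrix_add (c d : Matrix S.Strategy S.Strategy ℝ) :
    momentMatrix (c + d) = momentMatrix c + momentMatrix d := by
  simp only [momentMatrix, Matrix.mul_add, Matrix.add_mul]

lemma momentMatrix_smul (r : ℝ) (c : Matrix S.Strategy S.Strategy ℝ) :
    momentMatrix (r • c) = r • momentMatrix c := by
  simp only [momentMatrix, Matrix.mul_smul, Matrix.smul_mul]

/-- The combinations whose moment matrix is symmetric and vanishes at pairs of operators with
product zero. -/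
def momentSubspace (S : BellScenario) : Submodule ℝ (Matrix S.Strategy S.Strategy ℝ) where
  carrier := {c | cᵀ = c ∧ ∀ Q R, S.adjProd Q R = none → momentMatrix c Q R = 0}
  add_mem' := fun ⟨hc, hc'⟩ ⟨hd, hd'⟩ => ⟨by rw [Matrix.transpose_add, hc, hd], fun Q R h => by
    rw [momentMatrix_add, Matrix.add_apply, hc' Q R h, hd' Q R h, add_zero]⟩
  zero_mem' := ⟨Matrix.transpose_zero, fun _ _ _ => by simp [momentMatrix]⟩
  smul_mem' r c := fun ⟨hc, hc'⟩ => ⟨by rw [Matrix.transpose_smul, hc], fun Q R h => by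
    rw [momentMatrix_smul, Matrix.smul_apply, hc' Q R h, smul_zero]⟩

/-- The functions on deterministic strategies given by the formal operators. -/
def operatorFunctions (S : BellScenario) : Set (S.Strategy → ℝ) :=
  Set.range fun z => S.evalMatrix *ᵥ z

lemma momentMatrix_posSemidef {c : Matrix S.Strategy S.Strategy ℝ} (hc : cᵀ = c)
    (h : c ∈ nonnegOnCone S.operatorFunctions) : (momentMatrix c).PosSemidef := by
  refine .of_dotProduct_mulVec_nonneg ?_ fun z => ?_
  · rw [Matrix.IsHermitian, Matrix.conjTranspose_eq_transpose_of_trivial, momentMatrix,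
      Matrix.transpose_mul, Matrix.transpose_mul, hc, Matrix.transpose_transpose, Matrix.mul_assoc]
  · have h1 := h _ ⟨z, rfl⟩
    have h2 : matrixPairing (Matrix.vecMulVec (S.evalMatrix *ᵥ z) (S.evalMatrix *ᵥ z)) c =
        (S.evalMatrix *ᵥ z) ⬝ᵥ c *ᵥ (S.evalMatrix *ᵥ z) := by
      rw [← matrixPairing_vecMulVec]
      simp only [matrixPairing_apply]
      exact Finset.sum_congr rfl fun i _ => Finset.sum_congr rfl fun j _ => mul_comm _ _
    rw [h2] at h1
    rw [star_trivial, momentMatrix, Matrix.mul_assoc, ← Matrix.mulVec_mulVec,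
      ← Matrix.mulVec_mulVec, Matrix.dotProduct_mulVec, Matrix.vecMul_transpose]
    exact h1

lemma adjProd_self_some (e e' : S.Event) (he : e.1.1 = e'.1.1) (he' : e.2.1 = e'.2.1)
    (hne : e ≠ e') : S.adjProd (some e) (some e') = none := by
  obtain ⟨k, l⟩ := e
  obtain ⟨k', l'⟩ := e'
  by_cases hk : k = k'
  · have hl : l ≠ l' := fun hl => hne (by rw [hk, hl])
    simp only at he'
    simp [adjProd, localProd, hl, he']
  · simp only at he
    simp [adjProd, localProd, hk, he]

/-- At each strategy the events of a fixed input pair sum to 1; expanding the identity this way,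
only the event itself survives the zero products. -/
lemma momentMatrix_none_some {c : Matrix S.Strategy S.Strategy ℝ} (hc : c ∈ S.momentSubspace)
    (e : S.Event) : momentMatrix c none (some e) = momentMatrix c (some e) (some e) := by
  obtain ⟨⟨x, a⟩, ⟨y, b⟩⟩ := e
  have h1 : momentMatrix c none (some (⟨x, a⟩, ⟨y, b⟩)) = ∑ a', ∑ b',
      momentMatrix c (some (⟨x, a'⟩, ⟨y, b'⟩)) (some (⟨x, a⟩, ⟨y, b⟩)) := by
    simp only [momentMatrix_apply, evalMatrix_none, evalMatrix_some]
    rw [Finset.sum_congr rfl fun a _ => Finset.sum_comm, Finset.sum_comm]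
    refine Finset.sum_congr rfl fun s' _ => ?_
    simp only [← Finset.sum_mul]
    rw [Finset.sum_congr rfl fun a _ => Finset.sum_comm, Finset.sum_comm]
    congr 1
    refine Finset.sum_congr rfl fun s _ => ?_
    simp only [← Finset.sum_mul]
    rw [(detBox_isNoSignalling s).normalized]
  rw [h1, Finset.sum_eq_single a, Finset.sum_eq_single b]
  · intro b' _ hb'
    exact hc.2 _ _ (adjProd_self_some _ _ rfl rfl (by simpa using hb'))
  · simp
  · intro a' _ ha'
    refine Finset.sum_eq_zero fun b' _ => hc.2 _ _ (adjProd_self_some _ _ rfl rfl ?_)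
    simp [ha']
  · simp

lemma momentMatrix_comm {c : Matrix S.Strategy S.Strategy ℝ} (hc : c ∈ S.momentSubspace)
    (Q R : Option S.Event) : momentMatrix c Q R = momentMatrix c R Q := by
  have : (momentMatrix c)ᵀ = momentMatrix c := by
    rw [momentMatrix, Matrix.transpose_mul, Matrix.transpose_mul, hc.1,
      Matrix.transpose_transpose, Matrix.mul_assoc]
  exact congrFun (congrFun this R) Q

/-- An entry of a moment matrix is determined by the first and the last letters of the reduced
words of the product of its indices. -/
lemma momentMatrix_eq_of_adjProd {c : Matrix S.Strategy S.Strategy ℝ} (hc : c ∈ S.momentSubspace)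
    {Q R : Option S.Event} {u : List S.LetterA} {v : List S.LetterB}
    (h : S.adjProd Q R = some (u, v)) :
    momentMatrix c Q R = momentMatrix c (Option.map₂ Prod.mk u.head? v.head?)
      (Option.map₂ Prod.mk u.getLast? v.getLast?) := by
  have hlocal : ∀ {m : ℕ} {d : Fin m → ℕ} (k k' : Σ x : Fin m, Fin (d x)) (u),
      localProd (some k) (some k') = some u → u.head? = some k ∧ u.getLast? = some k' := by
    intro m d k k' u hu
    rw [localProd] at hu
    split_ifs at hu with h1 h2
    · obtain rfl := Option.some.inj hu
      simp [h1]
    · obtain rfl := Option.some.inj hu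
      simp
  rcases Q with _ | ⟨k, l⟩ <;> rcases R with _ | ⟨k', l'⟩
  · simp only [adjProd, localProd, Option.map_none, Option.map₂_some_some, Option.some.injEq,
      Prod.mk.injEq] at h
    obtain ⟨rfl, rfl⟩ := h
    rfl
  · simp only [adjProd, localProd, Option.map_none, Option.map_some, Option.map₂_some_some,
      Option.some.injEq, Prod.mk.injEq] at h
    obtain ⟨rfl, rfl⟩ := h
    exact momentMatrix_none_some hc _
  · simp only [adjProd, localProd, Option.map_none, Option.map_some, Option.map₂_some_some,
      Option.some.injEq, Prod.mk.injEq] at h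
    obtain ⟨rfl, rfl⟩ := h
    rw [momentMatrix_comm hc]
    exact momentMatrix_none_some hc _
  · simp only [adjProd, Option.map_some, Option.map₂_eq_some_iff, Prod.mk.injEq] at h
    obtain ⟨u', v', hu, hv, rfl, rfl⟩ := h
    rw [(hlocal _ _ _ hu).1, (hlocal _ _ _ hu).2, (hlocal _ _ _ hv).1, (hlocal _ _ _ hv).2]
    rfl

lemma momentMatrix_none_none (c : Matrix S.Strategy S.Strategy ℝ) :
    momentMatrix c none none = ∑ s', ∑ s, c s s' := by
  simp [momentMatrix_apply]

lemma isCertificate_momentMatrix {c : Matrix S.Strategy S.Strategy ℝ} (hc : c ∈ S.momentSubspace)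
    (hps : (momentMatrix c).PosSemidef) (h1 : momentMatrix c none none = 1) :
    S.IsCertificate (fun e => momentMatrix c none (some e))
      ((momentMatrix c).map ((↑) : ℝ → ℂ)) where
  posSemidef := by
    obtain ⟨B, hB⟩ := hps.exists_eq_transpose_mul
    have : (momentMatrix c).map ((↑) : ℝ → ℂ) =
        (B.map ((↑) : ℝ → ℂ))ᴴ * B.map ((↑) : ℝ → ℂ) := by
      rw [hB]
      ext i j
      simp [Matrix.mul_apply]
    rw [this]
    exact Matrix.posSemidef_conjTranspose_mul_self _
  one_one := by simp [h1]
  consistent Q R Q' R' h := by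
    simp only [Matrix.map_apply]
    congr 1
    rcases h' : S.adjProd Q R with _ | ⟨u, v⟩
    · rw [hc.2 Q R h', hc.2 Q' R' (h ▸ h')]
    · exact (momentMatrix_eq_of_adjProd hc h').trans
        (momentMatrix_eq_of_adjProd hc (h ▸ h')).symm
  eq_zero Q R h := by simp [hc.2 Q R h]
  box e := rfl

/-- The weights of the first marginal of a combination. -/
lemma momentMatrix_none_some_eq (c : Matrix S.Strategy S.Strategy ℝ) :
    (fun e => momentMatrix c none (some e)) = ∑ s', (∑ s, c s s') • S.detBox s' := by
  ext e
  simp [momentMatrix_apply]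

/-- The homogeneous form of validity: scale to a normalized certificate, or, if the corner entry is
zero, positivity annihilates the whole first row. -/
lemma nonneg_of_valid_on_almostQuantum {B : S.Box} {ω : ℝ}
    (hω : ∀ P ∈ S.almostQuantum, B ⬝ᵥ P ≤ ω) {c : Matrix S.Strategy S.Strategy ℝ}
    (hc : c ∈ S.momentSubspace) (hps : (momentMatrix c).PosSemidef) :
    B ⬝ᵥ (fun e => momentMatrix c none (some e)) ≤ ω * momentMatrix c none none := by
  set N := momentMatrix c none none with hN
  have hN0 : 0 ≤ N := hps.diag_nonneg
  rcases hN0.eq_or_lt with h0 | hpos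
  · have hcol : momentMatrix c *ᵥ Pi.single none 1 = 0 := by
      rw [← hps.dotProduct_mulVec_zero_iff]
      simp [← hN, ← h0]
    have hzero : (fun e => momentMatrix c none (some e)) = 0 := by
      ext e
      rw [momentMatrix_comm hc]
      simpa using congrFun hcol (some e)
    rw [hzero, ← h0]
    simp
  · have hc' : N⁻¹ • c ∈ S.momentSubspace := Submodule.smul_mem _ _ hc
    have hM := momentMatrix_smul N⁻¹ c
    have hps' : (momentMatrix (N⁻¹ • c)).PosSemidef := by
      rw [hM]
      exact hps.smul (inv_nonneg.2 hN0)
    have h1 : momentMatrix (N⁻¹ • c) none none = 1 := by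
      rw [hM, Matrix.smul_apply, ← hN, smul_eq_mul, inv_mul_cancel₀ hpos.ne']
    have hNS : S.IsNoSignalling fun e => momentMatrix (N⁻¹ • c) none (some e) := by
      rw [momentMatrix_none_some_eq]
      refine isNoSignalling_sum_smul_detBox ?_ fun e => ?_
      · rw [← h1, momentMatrix_none_none]
      · rw [← momentMatrix_none_some_eq]
        refine le_of_le_of_eq ?_ (momentMatrix_none_some hc' e).symm
        exact hps'.diag_nonneg
    have h := hω _ ⟨hNS, _, isCertificate_momentMatrix hc' hps' h1⟩
    have he : (fun e => momentMatrix (N⁻¹ • c) none (some e)) =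
        N⁻¹ • fun e => momentMatrix c none (some e) := by
      rw [hM]; rfl
    rw [he, dotProduct_smul, smul_eq_mul, inv_mul_le_iff₀ hpos] at h
    linarith

/-! ### Facets valid on the almost quantum set -/

/-- If a facet inequality of the classical polytope is valid on the almost quantum set, then the
form `β` dual to the certificates is a multiple of the square of the slack. -/
lemma exists_slack_factorization (hA : 0 < S.mA) (hB : 0 < S.mB) {B : S.Box} {ω : ℝ}
    (hF : IsFacet S.classical B ω) (hω : ∀ P ∈ S.almostQuantum, B ⬝ᵥ P ≤ ω) :
    ∃ κ : ℝ, 0 < κ ∧ ∀ c ∈ S.momentSubspace,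
      matrixPairing (.of fun _ s' => ω - B ⬝ᵥ S.detBox s') c =
        κ * matrixPairing (.of fun s s' => (ω - B ⬝ᵥ S.detBox s) * (ω - B ⬝ᵥ S.detBox s')) c := by
  classical
  set l : S.Strategy → ℝ := fun s => ω - B ⬝ᵥ S.detBox s with hl
  have hl0 : ∀ s, 0 ≤ l s := fun s => sub_nonneg.2 <|
    hF.valid _ (subset_convexHull ℝ _ (detBox_mem_localDeterministic s))
  -- A single strategy is a genuine classical model, so it respects zero products. This fixes the
  -- diagonal of `β` and puts the order unit in the subspace.
  have hmem : ∀ s : S.Strategy, Matrix.single s s (1 : ℝ) ∈ S.momentSubspace := fun s => by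
    rw [Matrix.single_eq_single_vecMulVec_single]
    refine ⟨Matrix.transpose_vecMulVec _ _, fun Q R hQR => ?_⟩
    rw [momentMatrix_vecMulVec, Matrix.vecMulVec_apply, Matrix.single_one_vecMul]
    rcases Q with _ | ⟨k, k'⟩ <;> rcases R with _ | ⟨j, j'⟩ <;>
      simp only [adjProd, localProd_none_left, localProd_none_right, Option.map_none, Option.map_some, Option.map₂_some_some,
        reduceCtorEq] at hQR
    simp only [Matrix.row_apply, evalMatrix_some, detBox]
    rw [Option.map₂_eq_none_iff] at hQR
    rcases hQR with h | h
    · linear_combination response s.2 k' * response s.2 j' *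
        response_mul_response_eq_zero s.1 (localProd_some_some_eq_none.1 h)
    · linear_combination response s.1 k * response s.1 j *
        response_mul_response_eq_zero s.2 (localProd_some_some_eq_none.1 h)
  have hone : (1 : Matrix S.Strategy S.Strategy ℝ) ∈ S.momentSubspace := by
    rw [← Matrix.sum_single_one]
    exact sum_mem fun s _ => hmem s
  have hpair : ∀ c, matrixPairing (.of fun _ s' => l s') c = ω * momentMatrix c none none -
      B ⬝ᵥ (fun e => momentMatrix c none (some e)) := fun c => by
    rw [momentMatrix_none_none, momentMatrix_none_some_eq, dotProduct_sum, Finset.mul_sum,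
      ← Finset.sum_sub_distrib, matrixPairing_apply, Finset.sum_comm]
    refine Finset.sum_congr rfl fun s' _ => ?_
    simp only [Matrix.of_apply]
    rw [dotProduct_smul, smul_eq_mul, ← Finset.sum_mul]
    ring
  obtain ⟨β, hβ, hβp, hβ0⟩ := exists_matrixPairing_extension S.operatorFunctions S.momentSubspace
    (fun c hc => hc.1) hone (.of fun _ s' => l s') fun c hc hc0 => by
      rw [hpair]
      exact sub_nonneg.2 (nonneg_of_valid_on_almostQuantum hω hc (momentMatrix_posSemidef hc.1 hc0))
  have hββ : ∀ s, β s s = l s := fun s => by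
    simpa [matrixPairing_apply, Matrix.single_apply, ite_and] using hβp _ (hmem s)
  have hsymm : ∀ s s', β s s' = β s' s := fun s s' => congrFun (congrFun hβ s') s
  have hface : ∀ s, l s = 0 → ∀ s', β s s' = 0 := fun s hs s' => by
    have := mulVec_eq_zero_of_nonnegOnCone hβ hβ0 (u := Pi.single s 1) (by simp [hββ, hs])
    rw [hsymm]
    simpa using congrFun this s'
  -- `β` kills every vector orthogonal to the operator functions, so its columns lie in their span
  -- and are affine functions of the deterministic box.
  have hrow : ∀ s', ∃ z : Option S.Event → ℝ, ∀ s, β s s' = z ⬝ᵥ S.evalMatrix s := fun s' => by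
    have hker : (LinearMap.proj s' ∘ₗ Matrix.mulVecLin β : Module.Dual ℝ (S.Strategy → ℝ)) ∈
        (LinearMap.ker (Matrix.mulVecLin S.evalMatrixᵀ)).dualAnnihilator := by
      rw [Submodule.mem_dualAnnihilator]
      intro u hu
      have : β *ᵥ u = 0 := by
        refine mulVec_eq_zero_of_forall_dotProduct_eq_zero hβ hβ0 ?_
        rintro _ ⟨z, rfl⟩
        have hu' : S.evalMatrixᵀ *ᵥ u = 0 := hu
        rw [dotProduct_comm, Matrix.dotProduct_mulVec, ← Matrix.mulVec_transpose, hu',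
          zero_dotProduct]
      simp [this]
    rw [← LinearMap.range_dualMap_eq_dualAnnihilator_ker] at hker
    obtain ⟨ψ, hψ⟩ := hker
    refine ⟨fun Q => ψ (Pi.single Q 1), fun s => ?_⟩
    have h1 := LinearMap.congr_fun hψ (Pi.single s 1)
    simp only [LinearMap.dualMap_apply, Matrix.mulVecLin_apply, LinearMap.comp_apply,
      LinearMap.proj_apply, Matrix.mulVec_single_one, Matrix.col_apply] at h1
    rw [hsymm, ← h1]
    conv_lhs => rw [pi_eq_sum_univ' (S.evalMatrixᵀ.col s)]
    simp [dotProduct, mul_comm, Matrix.col_apply]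
  have hprop : ∀ s', ∃ t : ℝ, ∀ s, β s s' = t * l s := fun s' => by
    obtain ⟨z, hz⟩ := hrow s'
    have hz' : ∀ s, β s s' = z none + (fun e => z (some e)) ⬝ᵥ S.detBox s := fun s => by
      rw [hz, dotProduct, Fintype.sum_option]
      simp [dotProduct]
    have hF' := hF
    rw [classical, localDeterministic_eq_range hA hB] at hF'
    obtain ⟨t, ht⟩ := hF'.exists_mul_eq (v := fun e => z (some e)) (k := z none) (by
      rintro _ ⟨s, rfl⟩ hs
      rw [← hz']
      exact hface s (sub_eq_zero.2 hs.symm) s')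
    exact ⟨t, fun s => by rw [hz', ht _ ⟨s, rfl⟩]⟩
  choose t ht using hprop
  obtain ⟨s₀, hs₀⟩ : ∃ s₀, l s₀ ≠ 0 := by
    by_contra! hall
    obtain ⟨P, hP, hlt⟩ := hF.exists_lt
    rw [classical, localDeterministic_eq_range hA hB] at hP
    -- With the trivial inequality `0 ≤ 0` the face is everything, so zero slack at all vertices
    -- would spread to the whole polytope.
    have := dotProduct_eq_zero_of_mem_convexHull (B := 0) (ω := 0) (v := -B) (k := ω)
      (s := Set.range S.detBox) (by simp) (by
        rintro _ ⟨s, rfl⟩ -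
        rw [neg_dotProduct]
        exact hall s) P hP (by simp)
    rw [neg_dotProduct] at this
    linarith
  have hpos : 0 < l s₀ := lt_of_le_of_ne (hl0 s₀) (Ne.symm hs₀)
  refine ⟨(l s₀)⁻¹, inv_pos.2 hpos, fun c hc => ?_⟩
  -- A symmetric matrix whose columns are multiples of `l` is a multiple of `l lᵀ`; the diagonal
  -- entry at `s₀` gives the constant.
  have hβl : ∀ s s', β s s' = (l s₀)⁻¹ * (l s * l s') := fun s s' => by
    have e1 : t s₀ = 1 := by
      have := ht s₀ s₀
      rw [hββ] at this
      exact mul_right_cancel₀ hs₀ (by linarith)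
    have e2 : t s' * l s₀ = l s' := by
      rw [← ht, hsymm, ht, e1, one_mul]
    rw [ht, ← e2]
    field_simp
  rw [← hβp c hc]
  simp only [matrixPairing_apply, hβl, Finset.mul_sum, Matrix.of_apply]
  exact Finset.sum_congr rfl fun s _ => Finset.sum_congr rfl fun s' _ => by ring

end BellScenario

/-! ### Test combinations, the projection-like slack, and the conclusion. -/

namespace BellScenario

variable {S : BellScenario}

/-- The product of (signed) mixtures of strategies of Alice and Bob. -/
def prodMixture (a : (∀ x, Fin (S.dA x)) → ℝ) (b : (∀ y, Fin (S.dB y)) → ℝ) : S.Strategy → ℝ :=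
  fun s => a s.1 * b s.2

lemma prodMixture_dotProduct (a : (∀ x, Fin (S.dA x)) → ℝ) (b : (∀ y, Fin (S.dB y)) → ℝ)
    (g : S.Strategy → ℝ) :
    prodMixture a b ⬝ᵥ g = a ⬝ᵥ fun f => b ⬝ᵥ fun h => g (f, h) := by
  simp only [dotProduct, prodMixture, Fintype.sum_prod_type, Finset.mul_sum, mul_assoc]

lemma prodMixture_vecMul_evalMatrix (a : (∀ x, Fin (S.dA x)) → ℝ)
    (b : (∀ y, Fin (S.dB y)) → ℝ) (k : S.LetterA) (l : S.LetterB) :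
    (prodMixture a b ᵥ* S.evalMatrix) (some (k, l)) =
      (a ⬝ᵥ fun f => response f k) * (b ⬝ᵥ fun h => response h l) := by
  change prodMixture a b ⬝ᵥ (fun s => S.detBox s (k, l)) = _
  rw [prodMixture_dotProduct]
  simp only [detBox, dotProduct, Finset.sum_mul, Finset.mul_sum]
  rw [Finset.sum_comm]
  exact Finset.sum_congr rfl fun f _ => Finset.sum_congr rfl fun h _ => by ring

/-- Mixtures of strategies of one party with orthogonal behaviours. -/
def IsOrthogonalMixture {m : ℕ} {d : Fin m → ℕ} (a a' : (∀ x, Fin (d x)) → ℝ) : Prop :=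
  ∀ k l : Σ x : Fin m, Fin (d x), k ≠ l → k.1 = l.1 →
    (a ⬝ᵥ fun f => response f k) * (a' ⬝ᵥ fun f => response f l) = 0

/-- A product of operators vanishes only through distinct outputs of one input on one side, and
orthogonality on that side kills both terms. -/
lemma symm_vecMulVec_prodMixture_mem {a a' : (∀ x, Fin (S.dA x)) → ℝ}
    {b b' : (∀ y, Fin (S.dB y)) → ℝ} (ha : IsOrthogonalMixture a a')
    (hb : IsOrthogonalMixture b b') :
    Matrix.vecMulVec (prodMixture a b) (prodMixture a' b') +
      Matrix.vecMulVec (prodMixture a' b') (prodMixture a b) ∈ S.momentSubspace := by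
  refine ⟨by rw [Matrix.transpose_add, Matrix.transpose_vecMulVec, Matrix.transpose_vecMulVec,
    add_comm], fun Q R hQR => ?_⟩
  rw [momentMatrix_add, Matrix.add_apply, momentMatrix_vecMulVec, momentMatrix_vecMulVec,
    Matrix.vecMulVec_apply, Matrix.vecMulVec_apply]
  rcases Q with _ | ⟨k, k'⟩ <;> rcases R with _ | ⟨j, j'⟩ <;>
    simp only [adjProd, localProd_none_left, localProd_none_right, Option.map_none,
      Option.map_some, Option.map₂_some_some, reduceCtorEq] at hQR
  simp only [prodMixture_vecMul_evalMatrix]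
  rw [Option.map₂_eq_none_iff] at hQR
  rcases hQR with h | h
  · obtain ⟨hne, heq⟩ := localProd_some_some_eq_none.1 h
    linear_combination (b ⬝ᵥ fun h => response h k') * (b' ⬝ᵥ fun h => response h j') *
      ha k j hne heq + (b' ⬝ᵥ fun h => response h k') * (b ⬝ᵥ fun h => response h j') *
      ha j k hne.symm heq.symm
  · obtain ⟨hne, heq⟩ := localProd_some_some_eq_none.1 h
    linear_combination (a ⬝ᵥ fun h => response h k) * (a' ⬝ᵥ fun h => response h j) *
      hb k' j' hne heq + (a' ⬝ᵥ fun h => response h k) * (a ⬝ᵥ fun h => response h j) *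
      hb j' k' hne.symm heq.symm

lemma sum_update_sub_sum_update {X : Type*} [Fintype X] [DecidableEq X] {α : X → Type*}
    (g : ∀ x, α x → ℝ) (f : ∀ x, α x) (x₀ : X) (a a' : α x₀) :
    ∑ x, g x (Function.update f x₀ a x) - ∑ x, g x (Function.update f x₀ a' x) =
      g x₀ a - g x₀ a' := by
  rw [← Finset.sum_sub_distrib, Finset.sum_eq_single x₀]
  · simp
  · intro x _ hx
    simp [Function.update_of_ne hx]
  · simp

section OneParty

variable {m : ℕ} {d : Fin m → ℕ}

/-- The difference of two strategies that differ at most in the answer to one input. -/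
def variation (f : ∀ x, Fin (d x)) (x : Fin m) (a a' : Fin (d x)) : (∀ x, Fin (d x)) → ℝ :=
  Pi.single (Function.update f x a) 1 - Pi.single (Function.update f x a') 1

lemma variation_dotProduct (f : ∀ x, Fin (d x)) (x : Fin m) (a a' : Fin (d x))
    (g : (∀ x, Fin (d x)) → ℝ) :
    variation f x a a' ⬝ᵥ g = g (Function.update f x a) - g (Function.update f x a') := by
  rw [variation, sub_dotProduct, single_one_dotProduct, single_one_dotProduct]

lemma isOrthogonalMixture_single (f : ∀ x, Fin (d x)) :
    IsOrthogonalMixture (Pi.single f 1) (Pi.single f 1) := fun k l hne heq => by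
  rw [single_one_dotProduct, single_one_dotProduct]
  exact response_mul_response_eq_zero f ⟨hne, heq⟩

/-- A variation at `x` has zero behaviour at every other input, so variations at different inputs
share no input. -/
lemma isOrthogonalMixture_variation (f f' : ∀ x, Fin (d x)) {x x' : Fin m} (hx : x ≠ x')
    (a₁ a₂ : Fin (d x)) (a₁' a₂' : Fin (d x')) :
    IsOrthogonalMixture (variation f x a₁ a₂) (variation f' x' a₁' a₂') := fun k l _ heq => by
  have h : ∀ (f : ∀ x, Fin (d x)) (x : Fin m) (a a' : Fin (d x)) (k : Σ x : Fin m, Fin (d x)),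
      k.1 ≠ x → (variation f x a a' ⬝ᵥ fun f => response f k) = 0 := fun f x a a' k hk => by
    rw [variation_dotProduct]
    simp [response, Function.update_of_ne hk]
  by_cases hk : k.1 = x
  · rw [h f' x' _ _ l (by rw [← heq, hk]; exact hx), mul_zero]
  · rw [h f x _ _ k hk, zero_mul]

end OneParty

/-- The slack of a facet inequality that is valid on the almost quantum set is, up to
normalization, projection-like. -/
lemma exists_isProjectionLike (hA : 0 < S.mA) (hB : 0 < S.mB) {B : S.Box} {ω : ℝ}
    (hF : IsFacet S.classical B ω) (hω : ∀ P ∈ S.almostQuantum, B ⬝ᵥ P ≤ ω) (s₀ : S.Strategy) :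
    ∃ κ : ℝ, 0 < κ ∧ ∃ L : ∀ x y, Fin (S.dA x) → Fin (S.dB y) → ℝ, IsProjectionLike L ∧
      ∀ s : S.Strategy, ∑ x, ∑ y, L x y (s.1 x) (s.2 y) = κ * (ω - B ⬝ᵥ S.detBox s) := by
  obtain ⟨κ, hκ, hfac⟩ := exists_slack_factorization hA hB hF hω
  -- The constant `ω` is spread evenly over the `mA * mB` input pairs.
  let L : ∀ x y, Fin (S.dA x) → Fin (S.dB y) → ℝ := fun x y a b =>
    κ * (ω / (S.mA * S.mB) - B (⟨x, a⟩, ⟨y, b⟩))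
  have hLs : ∀ s : S.Strategy, ∑ x, ∑ y, L x y (s.1 x) (s.2 y) = κ * (ω - B ⬝ᵥ S.detBox s) :=
    fun s => by
      have hA' : (S.mA : ℝ) ≠ 0 := by exact_mod_cast hA.ne'
      have hB' : (S.mB : ℝ) ≠ 0 := by exact_mod_cast hB.ne'
      rw [dotProduct_detBox]
      simp only [L, ← Finset.mul_sum, Finset.sum_sub_distrib, Finset.sum_const, Finset.card_univ,
        Fintype.card_fin, nsmul_eq_mul]
      congr 2
      field_simp
  -- For mixtures of total mass zero the linear side of the factorization vanishes, leaving the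
  -- product of the two slacks equal to zero.
  have htest : ∀ {a a' : (∀ x, Fin (S.dA x)) → ℝ} {b b' : (∀ y, Fin (S.dB y)) → ℝ},
      IsOrthogonalMixture a a' → IsOrthogonalMixture b b' →
      (a ⬝ᵥ (fun _ => 1)) * (b ⬝ᵥ fun _ => 1) = 0 →
      (a' ⬝ᵥ (fun _ => 1)) * (b' ⬝ᵥ fun _ => 1) = 0 →
      (a ⬝ᵥ fun f => b ⬝ᵥ fun h => ∑ x, ∑ y, L x y (f x) (h y)) *
        (a' ⬝ᵥ fun f => b' ⬝ᵥ fun h => ∑ x, ∑ y, L x y (f x) (h y)) = 0 := by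
    intro a a' b b' ha hb h0 h0'
    have h := hfac _ (symm_vecMulVec_prodMixture_mem ha hb)
    set l : S.Strategy → ℝ := fun s => ω - B ⬝ᵥ S.detBox s with hl
    have hsum : ∀ (a : (∀ x, Fin (S.dA x)) → ℝ) (b : (∀ y, Fin (S.dB y)) → ℝ),
        (a ⬝ᵥ fun f => b ⬝ᵥ fun h => ∑ x, ∑ y, L x y (f x) (h y)) =
          κ * (prodMixture a b ⬝ᵥ l) := fun a b => by
      rw [← smul_eq_mul, ← dotProduct_smul, prodMixture_dotProduct]
      congr 1
      ext f
      congr 1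
      ext h
      exact hLs (f, h)
    have hone : ∀ (a : (∀ x, Fin (S.dA x)) → ℝ) (b : (∀ y, Fin (S.dB y)) → ℝ),
        prodMixture a b ⬝ᵥ (fun _ => 1) = (a ⬝ᵥ (fun _ => 1)) * (b ⬝ᵥ fun _ => 1) := fun a b => by
      rw [prodMixture_dotProduct]
      simp [dotProduct, Finset.sum_mul]
    have h1 : (Matrix.of fun (_ s' : S.Strategy) => ω - B ⬝ᵥ S.detBox s') =
        Matrix.vecMulVec (fun _ => 1) l := by
      ext s s'
      simp [Matrix.vecMulVec_apply, hl]
    have h2 : (Matrix.of fun (s s' : S.Strategy) => (ω - B ⬝ᵥ S.detBox s) *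
        (ω - B ⬝ᵥ S.detBox s')) = Matrix.vecMulVec l l := rfl
    rw [h1, h2] at h
    simp only [map_add, matrixPairing_vecMulVec, Matrix.vecMulVec_mulVec, dotProduct_smul,
      op_smul_eq_smul, smul_eq_mul, hone, h0, h0'] at h
    rw [dotProduct_comm l, dotProduct_comm l] at h
    rw [hsum, hsum]
    linear_combination (-κ / 2) * h
  refine ⟨κ, hκ, L, ⟨?_, ?_, ?_⟩, hLs⟩
  · intro x x' y y' hx hy a₁ a₂ b₁ b₂ a₁' a₂' b₁' b₂'
    have h := htest (isOrthogonalMixture_variation s₀.1 s₀.1 hx a₁ a₂ a₁' a₂')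
      (isOrthogonalMixture_variation s₀.2 s₀.2 hy b₁ b₂ b₁' b₂')
      (by simp [variation_dotProduct]) (by simp [variation_dotProduct])
    have hval : ∀ x y a₁ a₂ b₁ b₂, (variation s₀.1 x a₁ a₂ ⬝ᵥ fun f =>
        variation s₀.2 y b₁ b₂ ⬝ᵥ fun h => ∑ x, ∑ y, L x y (f x) (h y)) =
        L x y a₁ b₁ - L x y a₂ b₁ - (L x y a₁ b₂ - L x y a₂ b₂) := fun x y a₁ a₂ b₁ b₂ => by
      simp only [variation_dotProduct]
      have e := fun h : ∀ y, Fin (S.dB y) =>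
        sum_update_sub_sum_update (fun x a => ∑ y, L x y a (h y)) s₀.1 x a₁ a₂
      have e1 := sum_update_sub_sum_update (fun y b => L x y a₁ b) s₀.2 y b₁ b₂
      have e2 := sum_update_sub_sum_update (fun y b => L x y a₂ b) s₀.2 y b₁ b₂
      linear_combination e (Function.update s₀.2 y b₁) - e (Function.update s₀.2 y b₂) + e1 - e2
    rwa [hval, hval] at h
  · intro h x x' hx a₁ a₂ a₁' a₂'
    have h1 := htest (isOrthogonalMixture_variation s₀.1 s₀.1 hx a₁ a₂ a₁' a₂')
      (isOrthogonalMixture_single h) (by simp [variation_dotProduct])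
      (by simp [variation_dotProduct])
    simp only [variation_dotProduct, single_one_dotProduct] at h1
    rw [sum_update_sub_sum_update (fun x a => ∑ y, L x y a (h y)),
      sum_update_sub_sum_update (fun x a => ∑ y, L x y a (h y))] at h1
    exact h1
  · intro f y y' hy b₁ b₂ b₁' b₂'
    have h1 := htest (isOrthogonalMixture_single f)
      (isOrthogonalMixture_variation s₀.2 s₀.2 hy b₁ b₂ b₁' b₂') (by simp [variation_dotProduct])
      (by simp [variation_dotProduct])
    simp only [variation_dotProduct, single_one_dotProduct] at h1
    simp only [Finset.sum_comm (s := (Finset.univ : Finset (Fin S.mA)))] at h1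
    rw [sum_update_sub_sum_update (fun y b => ∑ x, L x y (f x) b),
      sum_update_sub_sum_update (fun y b => ∑ x, L x y (f x) b)] at h1
    exact h1

lemma IsFacet.nonempty_strategy {B : S.Box} {ω : ℝ} (hF : IsFacet S.classical B ω) :
    Nonempty S.Strategy := by
  obtain ⟨hA, hB⟩ := mA_pos_mB_pos_of_isFacet hF
  obtain ⟨P, hP, -⟩ := hF.nonempty
  obtain ⟨D, hD⟩ := convexHull_nonempty_iff.1 ⟨P, hP⟩
  obtain ⟨s, -⟩ := exists_detBox_eq hA hB hD
  exact ⟨s⟩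

/-- A facet inequality of the classical polytope that is valid on the almost quantum set supports
a facet of the no-signalling polytope. -/
lemma isFacet_noSignalling_of_valid_on_almostQuantum {B : S.Box} {ω : ℝ}
    (hF : IsFacet S.classical B ω) (hω : ∀ P ∈ S.almostQuantum, B ⬝ᵥ P ≤ ω) :
    IsFacet S.noSignalling B ω := by
  obtain ⟨hA, hB⟩ := mA_pos_mB_pos_of_isFacet hF
  refine hF.of_subset classical_subset_noSignalling
    (noSignalling_subset_affineSpan_classical hA hB) fun P hP => ?_
  obtain ⟨s₀⟩ := hF.nonempty_strategy
  obtain ⟨w, hw, rfl⟩ := IsNoSignalling.exists_sum_smul_detBox hA hB hP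
  obtain ⟨κ, hκ, L, hL, hLs⟩ := exists_isProjectionLike hA hB hF hω s₀
  have h := sum_mul_nonneg_of_isProjectionLike hA hB hL (fun s => by
    rw [hLs]
    exact mul_nonneg hκ.le (sub_nonneg.2
      (hF.valid _ (subset_convexHull ℝ _ (detBox_mem_localDeterministic s))))) s₀
    hP.nonneg
  have heq : ∑ s : S.Strategy, w s * ∑ x, ∑ y, L x y (s.1 x) (s.2 y) =
      κ * (ω - B ⬝ᵥ ∑ s, w s • S.detBox s) := by
    have hω' : ω = ∑ s, w s * ω := by rw [← Finset.sum_mul, hw, one_mul]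
    conv_rhs => rw [hω', dotProduct_sum, ← Finset.sum_sub_distrib, Finset.mul_sum]
    refine Finset.sum_congr rfl fun s _ => ?_
    rw [hLs, dotProduct_smul, smul_eq_mul]
    ring
  rw [heq] at h
  exact sub_nonneg.1 (nonneg_of_mul_nonneg_right h hκ)

lemma exists_mem_quantum_lt {B : S.Box} {ω : ℝ} (h : S.IsFacetBellInequality B ω)
    (hv : value S.quantum B = value S.almostQuantum B) : ∃ P ∈ S.quantum, ω < B ⬝ᵥ P := by
  by_contra! hQ
  obtain ⟨hF, hNS⟩ := h
  -- This is where equality of values enters: it transfers the bound from quantum to almost quantum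
  -- boxes.
  refine hNS (isFacet_noSignalling_of_valid_on_almostQuantum hF fun P hP => ?_)
  obtain ⟨s₀⟩ := hF.nonempty_strategy
  calc B ⬝ᵥ P ≤ value S.almostQuantum B :=
        le_csSup (bddAbove_image_dotProduct B fun P hP e => ⟨hP.1.nonneg e, hP.1.le_one e⟩)
          ⟨P, hP, rfl⟩
    _ = value S.quantum B := hv.symm
    _ ≤ ω := csSup_le ⟨_, S.detBox s₀, detBox_mem_quantum s₀, rfl⟩ (by
        rintro _ ⟨P, hP, rfl⟩
        exact hQ P hP)

lemma IsFacet.value_eq {K : Set S.Box} {B : S.Box} {ω : ℝ} (h : IsFacet K B ω) :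
    value K B = ω := by
  obtain ⟨P, hP, hPω⟩ := h.nonempty
  refine IsGreatest.csSup_eq ⟨⟨P, hP, hPω⟩, ?_⟩
  rintro _ ⟨P, hP, rfl⟩
  exact h.valid P hP

end BellScenario

end

theorem mainTheorem2 :
    (∀ (S : BellScenario) (B : S.Box) (ω : ℝ),
      S.IsFacetBellInequality B ω →
      BellScenario.value S.quantum B = BellScenario.value S.almostQuantum B →
      ∃ P ∈ S.quantum, ω < B ⬝ᵥ P) ∧
    (∀ (mA mB : ℕ) (G : XORGame mA mB) (ω : ℝ),
      BellScenario.IsFacet (BellScenario.binary mA mB).classical G.bell ω →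
      BellScenario.value (BellScenario.binary mA mB).classical G.bell <
        BellScenario.value (BellScenario.binary mA mB).quantum G.bell) := by
  refine ⟨fun S B ω h hv => BellScenario.exists_mem_quantum_lt h hv, fun mA mB G ω h => ?_⟩
  obtain ⟨P, hP, hlt⟩ := G.exists_quantum_advantage h
  rw [h.value_eq]
  exact hlt.trans_le (le_csSup (BellScenario.bddAbove_image_dotProduct G.bell
    fun P hP e => BellScenario.mem_Icc_of_mem_quantum hP e) ⟨P, hP, rfl⟩)
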